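/- Let $\mathcal O$ be the ring of a reduced algebroid curve over an algebraically closed coefficient field $k$: a Noetherian complete local reduced $k$-algebra, with residue field $k$, of pure dimension one. Let $\wp_1,\dots,\wp_r$ ($r\ge 1$) be its distinct minimal primes, let $\mathcal K$ be its total ring of fractions, $\mathcal K_i$ the field of fractions of $\mathcal O/\wp_i$, $\pi_i:\mathcal K\to\mathcal K_i$ the projection, and $v_i$ the normalized discrete valuation of $\mathcal K_i$ whose valuation ring is the integral closure of $\mathcal O/\wp_i$ in $\mathcal K_i$, with $v_i(0)=\infty$. For $J\subseteq\{1,\dots,r\}$ let $\pi_J=(\pi_i)_{i\in J}:\mathcal K\to\prod_{i\in J}\mathcal K_i$. Let $\mathcal I\subset\mathcal K$ be a fractional ideal of $\mathcal O$, that is, an $\mathcal O$-submodule which contains a regular element of $\mathcal O$ and satisfies $d\,\mathcal I\subset\mathcal O$ for some regular $d\in\mathcal O$. For $J\neq\emptyset$ let $E_J\subset\mathbb Z^J$ be the set of the vectors $(v_i(h_i))_{i\in J}$, where $h=(h_i)_{i\in J}$ runs over the elements of $\pi_J(\mathcal I)$ with all components nonzero. Put $E=E_{\{1,\dots,r\}}$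 and $E_r=E_{\{r\}}$. For an $\mathcal O$-submodule $\mathcal N$ of $\mathcal K$, or of a product of the fields $\mathcal K_i$, let $\mathcal N(\alpha)$ be the submodule of those $h\in\mathcal N$ for which the $v_i$-value of the $i$-th component is at least $\alpha_i$ for all $i$. Write $\ell$ for the length of an $\mathcal O$-module. For $\alpha\in\mathbb Z^J$ and $A\subseteq J$ let $F_A(E_J,\alpha)$ be the set of $\beta\in E_J$ with $\beta_i=\alpha_i$ for $i\in A$ and $\beta_i>\alpha_i$ for $i\in J\setminus A$. If $\#J\ge 2$, the set $M(E_J)$ of maximal points consists of the $\alpha\in E_J$ such that $F_{\{i\}}(E_J,\alpha)=\emptyset$ for all $i\in J$; if $\#J=1$, then $M(E_J)$ is the set of gaps of $E_J$, that is, of the integers greater than $\min E_J$ which are not in $E_J$. The set $RM(E_J)$ of relative maximals consists of the $\alpha\in M(E_J)$ such that $F_A(E_J,\alpha)\ne\emptyset$ for all $A\subseteq J$ with $\#A\ge 2$. Then $E$ has a least element $m=(m_1,\dots,m_r)$ for the componentwise order. Moreover, let $\gamma\in\mathbb Z^r$ be such that $\gamma+\mathbb N^r\subset E$ (that is, $\gamma$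 is at least the conductor of $E$), let $I'=\{1,\dots,r-1\}$ and let $\gamma'=(\gamma_1,\dots,\gamma_{r-1})$. Then all the lengths and cardinalities below are finite, and $$\ell\left(\frac{\mathcal I}{\mathcal I(\gamma)}\right)=\ell\left(\frac{\pi_{I'}(\mathcal I)}{\pi_{I'}(\mathcal I)(\gamma')}\right)+(\gamma_r-m_r)-\#M(E_r)-\#\Bigl(\bigcup_{r\in J\subseteq\{1,\dots,r\},\ J\ne\{r\}}\{\beta_r:\ \beta\in RM(E_J)\}\Bigr),$$ where for $r=1$ the first term on the right is $0$. -/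

import Mathlib

open scoped nonZeroDivisors

noncomputable section

namespace AlgebroidCurve

/-- `O` is the ring of a reduced algebroid curve over the algebraically closed coefficient field
`k`: a Noetherian complete local `k`-algebra with residue field `k` (that is, a quotient of some
`k[[x₁, …, xₙ]]`), reduced, and of pure dimension one. -/
structure IsCurveRing (k O : Type*) [Field k] [CommRing O] [Algebra k O] : Prop
    extends IsLocalRing O, IsNoetherianRing O, IsReduced O where
  isAlgClosed : IsAlgClosed k
  complete : IsAdicComplete (IsLocalRing.maximalIdeal O) O
  coefficientField : Function.Bijective (algebraMap k (IsLocalRing.ResidueField O))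
  pureDimOne : ∀ p ∈ minimalPrimes O, ringKrullDim (O ⧸ p) = 1

/-- The order `v` on the fraction field `K` of a domain `A`, normalized by `v t = 1` for a
uniformizer `t` of the integral closure `Ã` of `A` in `K`: if `x = u * t ^ n` with `u` a unit and
`t` an irreducible element of `Ã`, then `v x = n`; moreover `v 0 = ∞`. When `Ã` is a discrete
valuation ring with fraction field `K` (the only case in use) every `x ≠ 0` has this form, with
a unique `n`; the last `else` is a dummy value. -/
def normalizedVal {A : Type*} [CommRing A] [IsDomain A] (x : FractionRing A) : WithTop ℤ :=
  open Classical in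
  if x = 0 then ⊤
  else if h : ∃ n : ℤ, ∃ t u : integralClosure A (FractionRing A),
      Irreducible t ∧ IsUnit u ∧ x = (u : FractionRing A) * (t : FractionRing A) ^ n
    then ((h.choose : ℤ) : WithTop ℤ)
  else 0

variable {O : Type*} [CommRing O]

instance (q : minimalPrimes O) : q.1.IsPrime := q.2.1.1

/-- The field of fractions `K_q` of the ring `O ⧸ q` of the branch given by `q`. -/
abbrev BranchField (q : minimalPrimes O) : Type _ := FractionRing (O ⧸ q.1)

/-- The valuation of the branch given by `q`. -/
def branchVal (q : minimalPrimes O) : BranchField q → WithTop ℤ := normalizedVal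

theorem isUnit_algebraMap_branchField (q : minimalPrimes O) (y : O⁰) :
    IsUnit (Algebra.ofId O (BranchField q) (y : O)) := by
  rw [Algebra.ofId_apply, IsScalarTower.algebraMap_apply O (O ⧸ q.1) (BranchField q),
    isUnit_iff_ne_zero, Ne, IsFractionRing.to_map_eq_zero_iff]
  intro h
  exact notMem_nonZeroDivisors_of_mem_mem_minimalPrimes
    (Ideal.Quotient.eq_zero_iff_mem.mp h) q.2 y.2

/-- The projection `π_q` from the total ring of fractions of `O` to `K_q`, extending
`O → O ⧸ q`. -/
def proj (q : minimalPrimes O) : FractionRing O →ₐ[O] BranchField q :=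
  IsLocalization.liftAlgHom (M := O⁰) (f := Algebra.ofId O (BranchField q))
    (isUnit_algebraMap_branchField q)

section Ideals

variable {κ : Type*}

/-- For a subfamily `q` of branches, the projection of the total ring of fractions of `O` to the
product of the fields of these branches. -/
def projPi (q : κ → minimalPrimes O) : FractionRing O →ₗ[O] (∀ j, BranchField (q j)) :=
  LinearMap.pi fun j => (proj (q j)).toLinearMap

/-- The value set, in `ℤ^κ`, of the image of `I` in the product of the fields of the branches `q`:
the value vectors of the elements all of whose components are nonzero (the regular elements). -/
def valueSet (q : κ → minimalPrimes O) (I : Submodule O (FractionRing O)) : Set (κ → ℤ) :=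
  {α | ∃ h ∈ Submodule.map (projPi q) I,
    ∀ j, h j ≠ 0 ∧ branchVal (q j) (h j) = ((α j : ℤ) : WithTop ℤ)}

/-- `N(α)`, for a submodule `N` of a module `M` mapped by `π` to a product of branch fields:
the elements of `N` whose values are `≥ α`, with `v 0 = ∞`. These elements already form
a submodule, so that taking the span adds nothing. -/
def truncation {M : Type*} [AddCommGroup M] [Module O M] (q : κ → minimalPrimes O)
    (π : M →ₗ[O] (∀ j, BranchField (q j))) (N : Submodule O M) (α : κ → ℤ) : Submodule O M :=
  Submodule.span O {h | h ∈ N ∧ ∀ j, ((α j : ℤ) : WithTop ℤ) ≤ branchVal (q j) (π h j)}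

/-- The colength `ℓ_O(N / N')` of `N'` in `N`. -/
def colength {M : Type*} [AddCommGroup M] [Module O M] (N N' : Submodule O M) : ℕ∞ :=
  Module.length O (N ⧸ N'.submoduleOf N)

end Ideals

section Maximals

variable {κ : Type*}

/-- `F_A(E, α)`. -/
def fiberOver (E : Set (κ → ℤ)) (A : Set κ) (α : κ → ℤ) : Set (κ → ℤ) :=
  {β | β ∈ E ∧ (∀ j ∈ A, β j = α j) ∧ ∀ j ∉ A, α j < β j}

/-- The fiber `F(E, α)`. -/
def fiber (E : Set (κ → ℤ)) (α : κ → ℤ) : Set (κ → ℤ) :=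
  ⋃ i, fiberOver E {i} α

/-- The set `M(E)` of maximal points of `E`; by convention, if there is only one coordinate, these
are the gaps of `E` (the elements above the minimum of `E` that are not in `E`). -/
def maximalPoints (E : Set (κ → ℤ)) : Set (κ → ℤ) :=
  {α | (Nat.card κ = 1 ∧ α ∉ E ∧ ∃ μ ∈ E, μ ≤ α) ∨
    (Nat.card κ ≠ 1 ∧ α ∈ E ∧ fiber E α = ∅)}

/-- The set `RM(E)` of relative maximals of `E`. -/
def relativeMaximals (E : Set (κ → ℤ)) : Set (κ → ℤ) :=
  {α | α ∈ maximalPoints E ∧ ∀ A : Set κ, 2 ≤ A.ncard → (fiberOver E A α).Nonempty}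

end Maximals

/-- The set `E_J`, for a set `J` of branches. -/
def valueSetOn {r : ℕ} (p : Fin r → minimalPrimes O) (I : Submodule O (FractionRing O))
    (J : Finset (Fin r)) : Set (J → ℤ) :=
  valueSet (fun j : J => p j) I

/-- The union of the sets `pr_s(RM(E_J))` over all `J` with `s ∈ J` and `J ≠ {s}`. -/
def relativeMaximalCoords {r : ℕ} (p : Fin r → minimalPrimes O)
    (I : Submodule O (FractionRing O)) (s : Fin r) : Set ℤ :=
  {a | ∃ (J : Finset (Fin r)) (hs : s ∈ J), J ≠ {s} ∧
    ∃ β ∈ relativeMaximals (valueSetOn p I J), β ⟨s, hs⟩ = a}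

end AlgebroidCurve

end

/-! Write `N` for the fractional ideal, `s` for the last branch, and `P` for the elements of `N`
whose orders at the other branches are at least `γ`. The colength of `N(γ)` splits as `ℓ(N/P) +
ℓ(P/N(γ))`. Since `P` is the preimage in `N` of the truncated projection, the first summand is the
length in the formula for one branch fewer (`colength_map`).

For the second, filter `P` by the order at `s`, from `m s` to `γ s`. The residue field of each
branch is `k`, so two elements of the same order agree up to a constant and higher terms. Each step
of the filtration thus has length 0 or 1, and 1 exactly when `P` has an element of that order
(`IsOrderFunction.colength_submodule`). So `ℓ(P/N(γ))` is `γ s - m s` minus the number of missed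
`a`: those for which no element of order `a` at `s` has orders at least `γ` elsewhere.

A missed `a` is either a gap at `s` or a value at `s`; the heart of the proof is that the missed
values are exactly the `s`-coordinates of the relative maximals. If `a` were such a coordinate and
not missed, the other orders could be pushed up indefinitely (`Reaches.of_conductor`), against
maximality. Conversely, for a missed value, a minimal unreachable vector of thresholds, restricted
to the coordinates where it imposes a condition and completed by `a`, is a relative maximal
(`mem_relMaxCoords_of_not_reaches`).

All this uses only four properties of the orders, collected in `IsOrderFunction`. They hold because
the normalization of each branch is Noetherian (Krull–Akizuki), local (completeness), and has
residue field `k`. -/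

namespace AlgebroidCurve

/-! ### Lengths of quotients of submodules -/

section Colength

variable {R M M' : Type*} [CommRing R] [AddCommGroup M] [Module R M] [AddCommGroup M'] [Module R M']

theorem mem_submoduleOf {N N' : Submodule R M} {x : N} : x ∈ N'.submoduleOf N ↔ (x : M) ∈ N' :=
  Iff.rfl

/-- The preimage of `N'` in `N` is the kernel of `N → f(N) / N'`. This brings lengths in a
projection back to the total ring of fractions. -/
theorem colength_map (f : M →ₗ[R] M') (N : Submodule R M) (N' : Submodule R M') :
    colength (N.map f) N' = colength N (N'.comap f) := by
  let g : N →ₗ[R] (N.map f) ⧸ N'.submoduleOf (N.map f) :=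
    (N'.submoduleOf (N.map f)).mkQ ∘ₗ f.submoduleMap N
  have hg : Function.Surjective g :=
    (Submodule.mkQ_surjective _).comp (f.submoduleMap_surjective N)
  have hk : LinearMap.ker g = (N'.comap f).submoduleOf N := by
    ext x
    rw [LinearMap.mem_ker, LinearMap.comp_apply, Submodule.mkQ_apply,
      Submodule.Quotient.mk_eq_zero]
    rfl
  unfold colength
  rw [← hk]
  exact (g.quotKerEquivOfSurjective hg).length_eq.symm

theorem colength_map_of_injective (f : M →ₗ[R] M') (hf : Function.Injective f)
    (N N' : Submodule R M) : colength (N.map f) (N'.map f) = colength N N' := by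
  rw [colength_map, Submodule.comap_map_eq_of_injective hf]

theorem colength_mono_right (N : Submodule R M) {N₁ N₂ : Submodule R M} (h : N₁ ≤ N₂) :
    colength N N₂ ≤ colength N N₁ :=
  Module.length_le_of_surjective
    (Submodule.factor (Submodule.comap_mono (f := N.subtype) h)) (Submodule.factor_surjective _)

theorem colength_top (N : Submodule R M) : colength ⊤ N = Module.length R (M ⧸ N) := by
  let g : (⊤ : Submodule R M) →ₗ[R] M ⧸ N := N.mkQ ∘ₗ (⊤ : Submodule R M).subtype
  have hg : Function.Surjective g := fun y => by
    obtain ⟨x, rfl⟩ := N.mkQ_surjective y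
    exact ⟨⟨x, trivial⟩, rfl⟩
  have hk : LinearMap.ker g = N.submoduleOf ⊤ := by
    ext x
    rw [LinearMap.mem_ker, LinearMap.comp_apply, Submodule.mkQ_apply,
      Submodule.Quotient.mk_eq_zero]
    rfl
  unfold colength
  rw [← hk]
  exact (g.quotKerEquivOfSurjective hg).length_eq

theorem colength_eq_add {N N' N'' : Submodule R M} (h' : N'' ≤ N') (h : N' ≤ N) :
    colength N N'' = colength N N' + colength N' N'' := by
  let i : N' ⧸ N''.submoduleOf N' →ₗ[R] N ⧸ N''.submoduleOf N :=
    Submodule.mapQ _ _ (Submodule.inclusion h) (fun x hx => hx)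
  let s : N ⧸ N''.submoduleOf N →ₗ[R] N ⧸ N'.submoduleOf N :=
    Submodule.mapQ _ _ LinearMap.id (fun x hx => h' hx)
  have hi : Function.Injective i := by
    rw [← LinearMap.ker_eq_bot, LinearMap.ker_eq_bot']
    intro x hx
    obtain ⟨x, rfl⟩ := Submodule.mkQ_surjective _ x
    rw [Submodule.mkQ_apply, show i (Submodule.Quotient.mk x) = Submodule.Quotient.mk
      (Submodule.inclusion h x) from rfl, Submodule.Quotient.mk_eq_zero] at hx
    rw [Submodule.mkQ_apply, Submodule.Quotient.mk_eq_zero]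
    exact hx
  have hs : ∀ y : N, s ((N''.submoduleOf N).mkQ y) = 0 ↔ (y : M) ∈ N' := fun y => by
    rw [Submodule.mkQ_apply, show s (Submodule.Quotient.mk y) = Submodule.Quotient.mk y from rfl,
      Submodule.Quotient.mk_eq_zero]
    rfl
  have he : Function.Exact i s := by
    intro y
    obtain ⟨y, rfl⟩ := Submodule.mkQ_surjective _ y
    rw [hs]
    constructor
    · intro hy
      exact ⟨Submodule.Quotient.mk ⟨y, hy⟩, rfl⟩
    · rintro ⟨x, hx⟩
      obtain ⟨x, rfl⟩ := Submodule.mkQ_surjective _ x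
      rw [← hs, ← hx]
      exact (hs (Submodule.inclusion h x)).mpr x.2
  have hs' : Function.Surjective s := fun y => by
    obtain ⟨y, rfl⟩ := Submodule.mkQ_surjective _ y
    exact ⟨Submodule.Quotient.mk y, rfl⟩
  unfold colength
  rw [Module.length_eq_add_of_exact i s hi hs' he, add_comm]

theorem colength_bot (N : Submodule R M) : colength N ⊥ = Module.length R N := by
  have h : (⊥ : Submodule R M).submoduleOf N = ⊥ := by
    ext x
    rw [mem_submoduleOf, Submodule.mem_bot, Submodule.mem_bot, Submodule.coe_eq_zero]
  unfold colength
  rw [h]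
  exact (Submodule.quotEquivOfEqBot _ rfl).length_eq

theorem colength_eq_zero_iff {N N' : Submodule R M} : colength N N' = 0 ↔ N ≤ N' := by
  rw [colength, Module.length_eq_zero_iff, Submodule.Quotient.subsingleton_iff,
    Submodule.submoduleOf_eq_top]

theorem one_le_colength {N N' : Submodule R M} (h : ¬ N ≤ N') : 1 ≤ colength N N' := by
  rwa [Order.one_le_iff_ne_zero, Ne, colength_eq_zero_iff]

/-- If any element outside `N'` generates `N` modulo `N'`, then `N / N'` has length one. -/
theorem colength_eq_one {N N' : Submodule R M} (h : ¬ N ≤ N')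
    (hgen : ∀ x ∈ N, ∀ y ∈ N, y ∉ N' → ∃ c : R, x - c • y ∈ N') : colength N N' = 1 := by
  rw [colength, Module.length_eq_one_iff, isSimpleModule_iff_toSpanSingleton_surjective]
  constructor
  · rw [← Module.length_pos_iff (R := R)]
    exact zero_lt_one.trans_le (one_le_colength h)
  · intro y hy x
    obtain ⟨x, rfl⟩ := Submodule.mkQ_surjective _ x
    obtain ⟨y, rfl⟩ := Submodule.mkQ_surjective _ y
    obtain ⟨c, hc⟩ := hgen x x.2 y y.2 fun h => hy ((Submodule.Quotient.mk_eq_zero _).mpr h)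
    refine ⟨c, ?_⟩
    rw [LinearMap.toSpanSingleton_apply, ← map_smul, eq_comm, ← sub_eq_zero, ← map_sub,
      Submodule.mkQ_apply, Submodule.Quotient.mk_eq_zero]
    exact hc

end Colength

/-! ### The Krull–Akizuki theorem -/

section KrullAkizuki

variable {A : Type*} [CommRing A] [IsDomain A] [IsNoetherianRing A] [Ring.KrullDimLE 1 A]

/-- Compute `ℓ(A/aQ)` through `Q` and through `aA`. As `ℓ(aA/aQ) = ℓ(A/Q)` is finite in dimension
one for `Q ≠ 0`, it cancels. -/
theorem colength_smul_ideal_le {a : A} (ha : a ≠ 0) (Q : Ideal A) :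
    colength Q (Submodule.map (LinearMap.lsmul A A a) Q) ≤ Module.length A (A ⧸ Ideal.span {a}) := by
  by_cases hQ : Q = ⊥
  · rw [colength_eq_zero_iff.mpr (by rw [hQ]; exact bot_le)]
    exact zero_le
  obtain ⟨b, hbQ, hb⟩ := Submodule.exists_mem_ne_zero_of_ne_bot hQ
  have hfin : colength ⊤ Q ≠ ⊤ := by
    refine ne_top_of_le_ne_top ?_
      (colength_mono_right ⊤ ((Ideal.span_singleton_le_iff_mem Q).mpr hbQ))
    rw [colength_top, Module.length_ne_top_iff]
    exact isFiniteLength_quotient_span_singleton A (mem_nonZeroDivisors_of_ne_zero hb)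
  have hinj : Function.Injective (LinearMap.lsmul A A a) := fun x y h => mul_left_cancel₀ ha h
  have h1 := colength_eq_add (N'' := Submodule.map (LinearMap.lsmul A A a) Q)
    (Submodule.map_le_iff_le_comap.mpr fun x hx => Q.smul_mem a hx) (le_top : Q ≤ ⊤)
  have h2 := colength_eq_add
    (Submodule.map_mono (f := LinearMap.lsmul A A a) (le_top : Q ≤ ⊤)) le_top
  have h4 : Ideal.span {a} = Submodule.map (LinearMap.lsmul A A a) (⊤ : Ideal A) := by
    ext x
    simp [Ideal.mem_span_singleton', mul_comm]
  rw [h1, colength_map_of_injective _ hinj, add_comm] at h2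
  rw [← colength_top, h4]
  exact (WithTop.add_right_cancel hfin h2).le

variable {B : Type*} [CommRing B] [IsDomain B] [Algebra A B] [FaithfulSMul A B]

omit [IsNoetherianRing A] [Ring.KrullDimLE 1 A] [IsDomain B] [FaithfulSMul A B] in
theorem exists_smul_mem_of_fg (hB : ∀ b : B, ∃ d : A, d ≠ 0 ∧ ∃ c : A, d • b = algebraMap A B c)
    {P : Submodule A B} (hP : P.FG) :
    ∃ d : A, d ≠ 0 ∧ ∀ b ∈ P, ∃ c : A, d • b = algebraMap A B c := by
  induction P, hP using Submodule.fg_induction with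
  | singleton x =>
    obtain ⟨d, hd, c, hc⟩ := hB x
    refine ⟨d, hd, fun b hb => ?_⟩
    obtain ⟨e, rfl⟩ := Submodule.mem_span_singleton.mp hb
    exact ⟨e * c, by rw [smul_comm, hc, Algebra.smul_def, map_mul]⟩
  | sup N₁ N₂ _ _ h₁ h₂ =>
    obtain ⟨d₁, hd₁, h₁⟩ := h₁
    obtain ⟨d₂, hd₂, h₂⟩ := h₂
    refine ⟨d₁ * d₂, mul_ne_zero hd₁ hd₂, fun b hb => ?_⟩
    obtain ⟨x, hx, y, hy, rfl⟩ := Submodule.mem_sup.mp hb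
    obtain ⟨c₁, hc₁⟩ := h₁ x hx
    obtain ⟨c₂, hc₂⟩ := h₂ y hy
    refine ⟨d₂ * c₁ + d₁ * c₂, ?_⟩
    rw [smul_add, mul_comm d₁, mul_smul, hc₁, mul_comm d₂, mul_smul, hc₂]
    simp [Algebra.smul_def]

/-- A common denominator `d` of `P` carries it isomorphically to an ideal of `A`, compatibly with
multiplication by `a`. -/
theorem colength_smul_le (hB : ∀ b : B, ∃ d : A, d ≠ 0 ∧ ∃ c : A, d • b = algebraMap A B c)
    {a : A} (ha : a ≠ 0) {P : Submodule A B} (hP : P.FG) :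
    colength P (P.map (LinearMap.lsmul A B a)) ≤ Module.length A (A ⧸ Ideal.span {a}) := by
  obtain ⟨d, hd, h⟩ := exists_smul_mem_of_fg hB hP
  have hinj : Function.Injective (LinearMap.lsmul A B d) := fun x y hxy => by
    simp only [LinearMap.lsmul_apply, Algebra.smul_def] at hxy
    exact mul_left_cancel₀ (by simpa using hd) hxy
  have hι : Function.Injective (Algebra.linearMap A B) := FaithfulSMul.algebraMap_injective A B
  let Q : Ideal A := (P.map (LinearMap.lsmul A B d)).comap (Algebra.linearMap A B)
  have hQ : Submodule.map (Algebra.linearMap A B) Q = P.map (LinearMap.lsmul A B d) := by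
    apply Submodule.map_comap_eq_of_le
    rintro _ ⟨b, hb, rfl⟩
    obtain ⟨c, hc⟩ := h b hb
    exact ⟨c, hc.symm⟩
  have h1 : LinearMap.lsmul A B d ∘ₗ LinearMap.lsmul A B a =
      LinearMap.lsmul A B a ∘ₗ LinearMap.lsmul A B d := LinearMap.ext fun x => smul_comm d a x
  have h2 : LinearMap.lsmul A B a ∘ₗ Algebra.linearMap A B =
      Algebra.linearMap A B ∘ₗ LinearMap.lsmul A A a :=
    LinearMap.ext fun x => (map_smul (Algebra.linearMap A B) a x).symm
  rw [← colength_map_of_injective _ hinj, ← Submodule.map_comp, h1, Submodule.map_comp, ← hQ,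
    ← Submodule.map_comp, h2, Submodule.map_comp, colength_map_of_injective _ hι]
  exact colength_smul_ideal_le ha Q

omit [IsDomain A] [IsNoetherianRing A] [Ring.KrullDimLE 1 A] in
-- Otherwise, adjoining new elements one by one gives finitely generated submodules of unbounded
-- length.
theorem finite_of_length_le {M : Type*} [AddCommGroup M] [Module A M] {L : ℕ∞} (hL : L ≠ ⊤)
    (h : ∀ P : Submodule A M, P.FG → Module.length A P ≤ L) : Module.Finite A M := by
  by_contra hM
  have key : ∀ n : ℕ, ∃ P : Submodule A M, P.FG ∧ (n : ℕ∞) ≤ Module.length A P := by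
    intro n
    induction n with
    | zero => exact ⟨⊥, Submodule.fg_bot, by simp⟩
    | succ n ih =>
      obtain ⟨P, hP, hn⟩ := ih
      have hne : P ≠ ⊤ := fun h => hM ⟨h ▸ hP⟩
      obtain ⟨x, -, hx⟩ := SetLike.exists_of_lt hne.lt_top
      refine ⟨P ⊔ Submodule.span A {x}, hP.sup (Submodule.fg_span_singleton x), ?_⟩
      have h1 : ¬ P ⊔ Submodule.span A {x} ≤ P := fun h =>
        hx (h (le_sup_right (a := P) (Submodule.mem_span_singleton_self x)))
      rw [← colength_bot, colength_eq_add bot_le (le_sup_left : P ≤ _), colength_bot P,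
        Nat.cast_add_one, add_comm]
      exact add_le_add (one_le_colength h1) hn
  lift L to ℕ using hL
  obtain ⟨P, hP, hn⟩ := key (L + 1)
  have := hn.trans (h P hP)
  norm_cast at this
  omega

/-- A finitely generated submodule of `B/aB` lifts to a finitely generated `P'` in `B` and is a
quotient of `P'/aP'`, so its length is at most `ℓ(A/aA)`. -/
theorem finite_quotient_span (hB : ∀ b : B, ∃ d : A, d ≠ 0 ∧ ∃ c : A, d • b = algebraMap A B c)
    {a : A} (ha : a ≠ 0) : Module.Finite A (B ⧸ Ideal.span {algebraMap A B a}) := by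
  refine finite_of_length_le (L := Module.length A (A ⧸ Ideal.span {a})) ?_ fun P hP => ?_
  · rw [Module.length_ne_top_iff]
    exact isFiniteLength_quotient_span_singleton A (mem_nonZeroDivisors_of_ne_zero ha)
  · let f : B →ₗ[A] (B ⧸ Ideal.span {algebraMap A B a}) :=
      (Ideal.Quotient.mkₐ A (Ideal.span {algebraMap A B a})).toLinearMap
    have hf : Function.Surjective f := Ideal.Quotient.mk_surjective
    obtain ⟨s, hs⟩ := hP
    choose g hg using hf
    classical
    let P' : Submodule A B := Submodule.span A ((s.image g : Finset B) : Set B)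
    have hP' : P'.map f = P := by
      rw [Submodule.map_span, ← hs, Finset.coe_image, ← Set.image_comp]
      congr 1
      convert! Set.image_id _
      exact funext hg
    rw [← colength_bot, ← hP', colength_map]
    refine (colength_mono_right P' (N₁ := P'.map (LinearMap.lsmul A B a)) ?_).trans (colength_smul_le hB ha ⟨_, rfl⟩)
    rintro _ ⟨y, -, rfl⟩
    rw [Submodule.mem_comap, Submodule.mem_bot]
    change Ideal.Quotient.mk _ (a • y) = 0
    rw [Ideal.Quotient.eq_zero_iff_mem, Algebra.smul_def]
    exact Ideal.mul_mem_right _ _ (Ideal.mem_span_singleton_self _)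

/-- The Krull–Akizuki theorem for the rings between `A` and its field of fractions. -/
theorem isNoetherianRing_of_krullDimLE_one
    (hB : ∀ b : B, ∃ d : A, d ≠ 0 ∧ ∃ c : A, d • b = algebraMap A B c) : IsNoetherianRing B := by
  refine ⟨fun J => ?_⟩
  by_cases hJ : J = ⊥
  · rw [hJ]
    exact Submodule.fg_bot
  obtain ⟨b, hbJ, hb⟩ := Submodule.exists_mem_ne_zero_of_ne_bot hJ
  obtain ⟨d, hd, a, hda⟩ := hB b
  have haJ : algebraMap A B a ∈ J := by
    rw [← hda, Algebra.smul_def]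
    exact Ideal.mul_mem_left J _ hbJ
  have ha : a ≠ 0 := by
    rintro rfl
    rw [map_zero, Algebra.smul_def, mul_eq_zero] at hda
    exact hda.elim (by simpa using hd) hb
  have := finite_quotient_span hB ha
  have h1 : IsNoetherian A (B ⧸ Ideal.span {algebraMap A B a}) := inferInstance
  have h2 : IsNoetherian B (B ⧸ Ideal.span {algebraMap A B a}) := isNoetherian_of_tower A h1
  -- `J` contains the principal ideal `aB`, and its image in the Noetherian module `B/aB` is
  -- finitely generated.
  refine Submodule.fg_of_fg_map_of_fg_inf_ker (Ideal.span {algebraMap A B a}).mkQ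
    (IsNoetherian.noetherian _) ?_
  rw [Submodule.ker_mkQ, inf_eq_right.mpr ((Ideal.span_singleton_le_iff_mem J).mpr haJ)]
  exact Submodule.fg_span_singleton _

end KrullAkizuki

end AlgebroidCurve

namespace AlgebroidCurve

/-! ### Integral domains over a complete local ring are local -/

section Complete

variable {R : Type*} [CommRing R]

/-- The completion of `M` is a quotient of the completion of `R` tensored with `M`, and `R` surjects
onto its completion. -/
theorem isPrecomplete_of_finite (I : Ideal R) [IsPrecomplete I R] (M : Type*) [AddCommGroup M]
    [Module R M] [Module.Finite R M] : IsPrecomplete I M := by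
  rw [← AdicCompletion.of_surjective_iff]
  intro y
  obtain ⟨z, rfl⟩ := AdicCompletion.ofTensorProduct_surjective_of_finite I M y
  induction z with
  | zero => exact ⟨0, by simp⟩
  | add a b ha hb =>
    obtain ⟨x, hx⟩ := ha
    obtain ⟨y, hy⟩ := hb
    exact ⟨x + y, by rw [map_add, map_add, hx, hy]⟩
  | tmul r x =>
    obtain ⟨s, rfl⟩ := AdicCompletion.of_surjective I R r
    refine ⟨s • x, ?_⟩
    rw [AdicCompletion.ofTensorProduct_tmul, map_smul]
    ext n
    rfl

/-- An idempotent modulo an ideal at which the ring is Henselian is congruent to `0` or `1`, if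
the ring is a domain. -/
theorem HenselianRing.mem_or_one_sub_mem {S : Type*} [CommRing S] [IsDomain S] (I : Ideal S)
    [HenselianRing S I] {e : S} (he : e * e - e ∈ I) : e ∈ I ∨ 1 - e ∈ I := by
  open Polynomial in
  have hm : (X ^ 2 - X : S[X]).Monic := by
    apply monic_X_pow_sub
    simp
  obtain ⟨a, ha, hae⟩ := HenselianRing.is_henselian (I := I) _ hm e
    (by simpa [sq] using he) (by
      rw [isUnit_iff_exists_inv]
      -- The derivative `2e - 1` is its own inverse modulo `I`, as `(2e - 1)² - 1 = 4(e² - e)`.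
      refine ⟨Ideal.Quotient.mk I (2 * e - 1), ?_⟩
      rw [← map_mul, ← map_one (Ideal.Quotient.mk I), Ideal.Quotient.eq]
      have : Polynomial.eval e (Polynomial.derivative (Polynomial.X ^ 2 - Polynomial.X : Polynomial S))
          * (2 * e - 1) - 1 = 4 * (e * e - e) := by
        simp
        ring
      rw [this]
      exact I.mul_mem_left _ he)
  have h0 : a * (a - 1) = 0 := by
    have : a ^ 2 - a = 0 := by simpa [Polynomial.IsRoot] using ha
    linear_combination this
  rcases mul_eq_zero.mp h0 with h | h
  · left
    rw [h, zero_sub] at hae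
    simpa using I.neg_mem hae
  · right
    rwa [sub_eq_zero.mp h] at hae

/-- A domain that is finite over a complete Noetherian local ring is local. -/
theorem isUnit_or_isUnit_one_sub_of_finite [IsLocalRing R] [IsNoetherianRing R]
    [IsAdicComplete (IsLocalRing.maximalIdeal R) R] (S : Type*) [CommRing S] [IsDomain S]
    [Algebra R S] [Module.Finite R S] (x : S) : IsUnit x ∨ IsUnit (1 - x) := by
  let m := IsLocalRing.maximalIdeal R
  let I : Ideal S := m.map (algebraMap R S)
  have h1 : IsPrecomplete m S := isPrecomplete_of_finite m S
  have h2 : IsAdicComplete m S := ⟨⟩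
  have h3 : IsAdicComplete I S := (IsAdicComplete.map_algebraMap_iff m S).mpr h2
  have hjac : I ≤ (⊥ : Ideal S).jacobson := IsAdicComplete.le_jacobson_bot I
  have hunit : ∀ y ∈ I, IsUnit (1 - y) := fun y hy => by
    have := Ideal.mem_jacobson_bot.mp (hjac hy) (-1)
    rwa [mul_neg_one, neg_add_eq_sub] at this
  have h4 : IsArtinian (S ⧸ I) (S ⧸ I) := by
    let _ : Field (R ⧸ m) := Ideal.Quotient.field m
    let _ : Algebra (R ⧸ m) (S ⧸ I) := (Ideal.quotientMap I (algebraMap R S)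
      Ideal.le_comap_map).toAlgebra
    have : IsScalarTower R (R ⧸ m) (S ⧸ I) := IsScalarTower.of_algebraMap_eq' rfl
    have : Module.Finite R (S ⧸ I) := inferInstance
    have : Module.Finite (R ⧸ m) (S ⧸ I) := Module.Finite.of_restrictScalars_finite R _ _
    have h5 : IsArtinian (R ⧸ m) (S ⧸ I) := inferInstance
    exact isArtinian_of_tower (R ⧸ m) h5
  -- In the Artinian ring `S/I` the powers of `x` stabilize up to multiples, which makes `xⁿyⁿ`
  -- idempotent modulo `I`. According to whether it is 0 or 1 there, `1 - x` or `x` is a unit.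
  obtain ⟨n, y, hy⟩ := IsArtinian.exists_pow_succ_smul_dvd (Ideal.Quotient.mk I x) (1 : S ⧸ I)
  obtain ⟨y, rfl⟩ := Ideal.Quotient.mk_surjective y
  have hy' : x ^ (n + 1) * y - x ^ n ∈ I := by
    rw [← Ideal.Quotient.eq]
    simpa using hy
  have hk : ∀ k : ℕ, x ^ (n + k) * y ^ k - x ^ n ∈ I := by
    intro k
    induction k with
    | zero => simp
    | succ k ih =>
      have : x ^ (n + (k + 1)) * y ^ (k + 1) - x ^ n =
          x ^ k * y ^ k * (x ^ (n + 1) * y - x ^ n) + (x ^ (n + k) * y ^ k - x ^ n) := by ring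
      rw [this]
      exact I.add_mem (I.mul_mem_left _ hy') ih
  have he : (x ^ n * y ^ n) * (x ^ n * y ^ n) - x ^ n * y ^ n ∈ I := by
    have : (x ^ n * y ^ n) * (x ^ n * y ^ n) - x ^ n * y ^ n =
        y ^ n * (x ^ (n + n) * y ^ n - x ^ n) := by ring
    rw [this]
    exact I.mul_mem_left _ (hk n)
  rcases HenselianRing.mem_or_one_sub_mem I he with h | h
  · right
    have hxn : x ^ n ∈ I := by
      have : x ^ n = x ^ n * (x ^ n * y ^ n) - (x ^ (n + n) * y ^ n - x ^ n) := by ring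
      rw [this]
      exact I.sub_mem (I.mul_mem_left _ h) (hk n)
    obtain ⟨z, hz⟩ : (1 - x) ∣ 1 - x ^ n := by
      simpa using sub_dvd_pow_sub_pow 1 x n
    exact isUnit_of_mul_isUnit_left (hz ▸ hunit _ hxn)
  · left
    have h6 := hunit _ h
    rw [sub_sub_cancel] at h6
    -- For `n = 0` the idempotent is 1 and says nothing about `x`; the stabilization itself then
    -- reads `xy ≡ 1`.
    rcases Nat.eq_zero_or_pos n with rfl | hn
    · have h7 := hunit _ (I.neg_mem hy')
      simp only [zero_add, pow_one, pow_zero, neg_sub, sub_sub_cancel] at h7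
      exact isUnit_of_mul_isUnit_left h7
    · exact (isUnit_pow_iff hn.ne').mp (isUnit_of_mul_isUnit_left h6)

/-- Whether `x` or `1 - x` is a unit is decided in `R[x]`, which is finite over `R`. -/
theorem isLocalRing_of_isIntegral [IsLocalRing R] [IsNoetherianRing R]
    [IsAdicComplete (IsLocalRing.maximalIdeal R) R] (S : Type*) [CommRing S] [IsDomain S]
    [Algebra R S] [Algebra.IsIntegral R S] : IsLocalRing S := by
  refine IsLocalRing.of_isUnit_or_isUnit_one_sub_self fun x => ?_
  let T := Algebra.adjoin R {x}
  have : Module.Finite R T :=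
    Module.Finite.iff_fg.mpr (Algebra.IsIntegral.isIntegral (R := R) x).fg_adjoin_singleton
  have h := isUnit_or_isUnit_one_sub_of_finite (R := R) T ⟨x, Algebra.self_mem_adjoin_singleton R x⟩
  exact h.imp (fun h => h.map T.val) fun h => by simpa using h.map T.val

end Complete

/-! ### The normalization of a branch -/

section Normalization

variable {A : Type*} [CommRing A] [IsDomain A]

theorem exists_smul_eq_algebraMap (b : integralClosure A (FractionRing A)) :
    ∃ d : A, d ≠ 0 ∧ ∃ c : A, d • b = algebraMap A (integralClosure A (FractionRing A)) c := by
  obtain ⟨⟨c, d⟩, h⟩ := IsLocalization.surj A⁰ (b : FractionRing A)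
  refine ⟨d, nonZeroDivisors.ne_zero d.2, c, ?_⟩
  apply Subtype.ext
  rw [Algebra.smul_def, mul_comm]
  exact h

instance isFractionRing_normalization :
    IsFractionRing (integralClosure A (FractionRing A)) (FractionRing A) :=
  have : Algebra.IsAlgebraic A (FractionRing A) := IsLocalization.isAlgebraic (FractionRing A) A⁰
  integralClosure.isFractionRing_of_algebraic
    fun x hx => by simpa using hx

/-- Krull–Akizuki makes the normalization Noetherian without knowing it finite over `A`. It is then
a local Dedekind domain, and not a field, since `A` would be one too. -/
theorem isDiscreteValuationRing_normalization [IsNoetherianRing A] (hdim : ringKrullDim A = 1)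
    [IsLocalRing (integralClosure A (FractionRing A))] :
    IsDiscreteValuationRing (integralClosure A (FractionRing A)) := by
  have h1 : Ring.KrullDimLE 1 A := Ring.krullDimLE_iff.mpr hdim.le
  have h2 : Ring.DimensionLEOne A :=
    ⟨fun {p} hp _ => Ring.krullDimLE_one_iff_of_noZeroDivisors.mp h1 p hp ‹_›⟩
  have h3 : IsNoetherianRing (integralClosure A (FractionRing A)) :=
    isNoetherianRing_of_krullDimLE_one (A := A) exists_smul_eq_algebraMap
  have h4 : IsIntegrallyClosed (integralClosure A (FractionRing A)) :=
    integralClosure.isIntegrallyClosedOfFiniteExtension (FractionRing A)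
  have h5 : IsDedekindDomain (integralClosure A (FractionRing A)) := { }
  have h6 : ¬ IsField (integralClosure A (FractionRing A)) := fun h => by
    have hA : IsField A := isField_of_isIntegral_of_isField
      (FaithfulSMul.algebraMap_injective A (integralClosure A (FractionRing A))) h
    rw [ringKrullDim_eq_zero_of_isField hA] at hdim
    exact zero_ne_one hdim
  exact ((IsDiscreteValuationRing.TFAE _ h6).out 0 2).mpr h5

end Normalization

/-- Over a local ring whose residue field is the algebraically closed field `k`, an integral local
ring has residue field `k`. -/
theorem exists_sub_algebraMap_mem_maximalIdeal {k R S : Type*} [Field k] [IsAlgClosed k]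
    [CommRing R] [IsLocalRing R] [Algebra k R]
    (hk : Function.Bijective (algebraMap k (IsLocalRing.ResidueField R)))
    [CommRing S] [IsLocalRing S] [Algebra R S] [Algebra.IsIntegral R S] (x : S) :
    ∃ c : k, x - algebraMap R S (algebraMap k R c) ∈ IsLocalRing.maximalIdeal S := by
  let f : k →+* S := (algebraMap R S).comp (algebraMap k R)
  let g : k →+* IsLocalRing.ResidueField S := (IsLocalRing.residue S).comp f
  have hg : g.IsIntegral := by
    have : IsLocalHom (algebraMap R S) := by
      refine ⟨fun a ha => ?_⟩
      have h := IsLocalRing.eq_maximalIdeal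
        (Ideal.isMaximal_comap_of_isIntegral_of_isMaximal (R := R) (IsLocalRing.maximalIdeal S))
      contrapose! ha
      rwa [← mem_nonunits_iff, ← IsLocalRing.mem_maximalIdeal, ← h, Ideal.mem_comap] at ha
    let e : IsLocalRing.ResidueField R →+* IsLocalRing.ResidueField S :=
      IsLocalRing.ResidueField.map (algebraMap R S)
    have he : e.IsIntegral := by
      have h : (e.comp (IsLocalRing.residue R)).IsIntegral := by
        have : e.comp (IsLocalRing.residue R) = (IsLocalRing.residue S).comp (algebraMap R S) :=
          IsLocalRing.ResidueField.map_comp_residue _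
        rw [this]
        exact RingHom.IsIntegral.trans _ _ (algebraMap_isIntegral_iff.mpr inferInstance)
          ((IsLocalRing.residue S).isIntegral_of_surjective IsLocalRing.residue_surjective)
      exact RingHom.IsIntegral.tower_top _ _ h
    have h : g = e.comp (algebraMap k (IsLocalRing.ResidueField R)) := rfl
    rw [h]
    exact RingHom.IsIntegral.trans _ _ (RingHom.isIntegral_of_surjective _ hk.2) he
  obtain ⟨c, hc⟩ := (IsAlgClosed.ringHom_bijective_of_isIntegral g hg).2 (IsLocalRing.residue S x)
  refine ⟨c, ?_⟩
  rw [← IsLocalRing.residue_eq_zero_iff, map_sub, ← hc, sub_eq_zero]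
  rfl

end AlgebroidCurve

namespace AlgebroidCurve

/-! ### The normalized valuation -/

section NormalizedVal

variable {A : Type*} [CommRing A] [IsDomain A]

theorem normalizedVal_zero : normalizedVal (0 : FractionRing A) = ⊤ := if_pos rfl

variable [IsDiscreteValuationRing (integralClosure A (FractionRing A))]
  {t : integralClosure A (FractionRing A)}

omit [IsDiscreteValuationRing (integralClosure A (FractionRing A))] in
theorem eq_zero_of_zpow_eq_unit (ht : Irreducible t)
    {e : (integralClosure A (FractionRing A))ˣ} {n : ℤ}
    (h : (t : FractionRing A) ^ n = (e : integralClosure A (FractionRing A))) : n = 0 := by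
  have key : ∀ (m : ℕ) (e : (integralClosure A (FractionRing A))ˣ),
      (t : FractionRing A) ^ m = (e : integralClosure A (FractionRing A)) → m = 0 := by
    intro m e h
    have h' : t ^ m = (e : integralClosure A (FractionRing A)) := Subtype.ext h
    by_contra hm
    exact ht.not_isUnit ((isUnit_pow_iff hm).mp (h' ▸ e.isUnit))
  obtain ⟨m, rfl | rfl⟩ := n.eq_nat_or_neg
  · rw [zpow_natCast] at h
    simpa using key m e h
  · rw [zpow_neg, zpow_natCast] at h
    have h2 : (t : FractionRing A) ^ m =
        ((e⁻¹ : (integralClosure A (FractionRing A))ˣ) : integralClosure A (FractionRing A)) := by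
      rw [inv_eq_iff_eq_inv] at h
      rw [h]
      exact inv_eq_of_mul_eq_one_right (congrArg Subtype.val (Units.mul_inv e))
    simpa using key m _ h2

/-- The exponent chosen in the definition does not depend on the representation: two uniformizers
are associated, and no nonzero power of one is a unit. -/
theorem normalizedVal_unit_mul_zpow (ht : Irreducible t)
    (e : (integralClosure A (FractionRing A))ˣ) (n : ℤ) :
    normalizedVal (((e : integralClosure A (FractionRing A)) : FractionRing A) *
      (t : FractionRing A) ^ n) = n := by
  have hcoe : ∀ e : (integralClosure A (FractionRing A))ˣ,
      ((e : integralClosure A (FractionRing A)) : FractionRing A) ≠ 0 :=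
    fun e h0 => e.ne_zero (Subtype.ext h0)
  have ht0 : (t : FractionRing A) ≠ 0 := fun h0 => ht.ne_zero (Subtype.ext h0)
  have hx : ((e : integralClosure A (FractionRing A)) : FractionRing A) *
      (t : FractionRing A) ^ n ≠ 0 := mul_ne_zero (hcoe e) (zpow_ne_zero _ ht0)
  have h : ∃ m : ℤ, ∃ t' u : integralClosure A (FractionRing A),
      Irreducible t' ∧ IsUnit u ∧ ((e : integralClosure A (FractionRing A)) : FractionRing A) *
      (t : FractionRing A) ^ n = (u : FractionRing A) * (t' : FractionRing A) ^ m :=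
    ⟨n, t, e, ht, e.isUnit, rfl⟩
  rw [normalizedVal, if_neg hx, dif_pos h]
  obtain ⟨t', u, ht', ⟨u, rfl⟩, hu⟩ := h.choose_spec
  generalize h.choose = m at hu
  obtain ⟨f, rfl⟩ := IsDiscreteValuationRing.associated_of_irreducible _ ht ht'
  have h1 : (t : FractionRing A) ^ (n - m) =
      ((e⁻¹ * u * f ^ m : (integralClosure A (FractionRing A))ˣ) :
        integralClosure A (FractionRing A)) := by
    let φ : (integralClosure A (FractionRing A))ˣ →* (FractionRing A)ˣ :=
      Units.map (integralClosure A (FractionRing A)).val.toMonoidHom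
    have hφ : ∀ e : (integralClosure A (FractionRing A))ˣ, ((e : integralClosure A (FractionRing A)) : FractionRing A) = φ e :=
      fun e => rfl
    rw [hφ, map_mul, map_mul, map_inv, map_zpow, Units.val_mul, Units.val_mul,
      Units.val_zpow_eq_zpow_val, zpow_sub₀ ht0, Units.val_inv_eq_inv_val]
    rw [Subalgebra.coe_mul, hφ, hφ, hφ, mul_zpow] at hu
    have h2 := (φ e).ne_zero
    have h3 := zpow_ne_zero m ht0
    field_simp
    linear_combination hu
  have := eq_zero_of_zpow_eq_unit ht h1
  rw [show m = n by omega]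

theorem exists_eq_unit_mul_zpow (ht : Irreducible t) {x : FractionRing A} (hx : x ≠ 0) :
    ∃ (e : (integralClosure A (FractionRing A))ˣ) (n : ℤ),
      x = ((e : integralClosure A (FractionRing A)) : FractionRing A) *
        (t : FractionRing A) ^ n := by
  have ht0 : (t : FractionRing A) ≠ 0 := fun h0 => ht.ne_zero (Subtype.ext h0)
  obtain ⟨b, c, hc, rfl⟩ := IsFractionRing.div_surjective (A := integralClosure A (FractionRing A)) x
  have hc0 := nonZeroDivisors.ne_zero hc
  have hb0 : b ≠ 0 := fun h => hx (by rw [h, map_zero, zero_div])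
  obtain ⟨i, e, rfl⟩ := IsDiscreteValuationRing.eq_unit_mul_pow_irreducible hb0 ht
  obtain ⟨j, f, rfl⟩ := IsDiscreteValuationRing.eq_unit_mul_pow_irreducible hc0 ht
  refine ⟨e * f⁻¹, i - j, ?_⟩
  have h1 : ((f : integralClosure A (FractionRing A)) : FractionRing A) *
      ((f⁻¹ : (integralClosure A (FractionRing A))ˣ) : integralClosure A (FractionRing A)) = 1 :=
    congrArg Subtype.val (Units.mul_inv f)
  have h2 : ((f : integralClosure A (FractionRing A)) : FractionRing A) ≠ 0 :=
    left_ne_zero_of_mul_eq_one h1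
  change (((e : integralClosure A (FractionRing A)) : FractionRing A) * (t : FractionRing A) ^ i) /
    (((f : integralClosure A (FractionRing A)) : FractionRing A) * (t : FractionRing A) ^ j) =
    (((e : integralClosure A (FractionRing A)) : FractionRing A) *
    ((f⁻¹ : (integralClosure A (FractionRing A))ˣ) : integralClosure A (FractionRing A))) * _
  rw [zpow_sub₀ ht0, zpow_natCast, zpow_natCast, eq_inv_of_mul_eq_one_right h1]
  field_simp

/-- The elements of order at least `n` form the module generated by `tⁿ` over the normalization; the
ultrametric inequality follows from this. -/
theorem le_normalizedVal_iff (ht : Irreducible t) {x : FractionRing A} {n : ℤ} :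
    (n : WithTop ℤ) ≤ normalizedVal x ↔
      ∃ b : integralClosure A (FractionRing A), x = b * (t : FractionRing A) ^ n := by
  have ht0 : (t : FractionRing A) ≠ 0 := fun h0 => ht.ne_zero (Subtype.ext h0)
  by_cases hx : x = 0
  · subst hx
    exact iff_of_true (normalizedVal_zero (A := A) ▸ le_top) ⟨0, by simp⟩
  constructor
  · obtain ⟨e, m, rfl⟩ := exists_eq_unit_mul_zpow ht hx
    rw [normalizedVal_unit_mul_zpow ht, WithTop.coe_le_coe]
    intro h
    obtain ⟨i, rfl⟩ := Int.le.dest h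
    refine ⟨e * t ^ i, ?_⟩
    rw [zpow_add₀ ht0, zpow_natCast, Subalgebra.coe_mul, Subalgebra.coe_pow]
    ring
  · rintro ⟨b, rfl⟩
    have hb : b ≠ 0 := by
      rintro rfl
      simp at hx
    obtain ⟨i, e, rfl⟩ := IsDiscreteValuationRing.eq_unit_mul_pow_irreducible hb ht
    have : (((e : integralClosure A (FractionRing A)) * t ^ i :
        integralClosure A (FractionRing A)) : FractionRing A) * (t : FractionRing A) ^ n =
        ((e : integralClosure A (FractionRing A)) : FractionRing A) *
        (t : FractionRing A) ^ (i + n) := by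
      rw [zpow_add₀ ht0, zpow_natCast, Subalgebra.coe_mul, Subalgebra.coe_pow]
      ring
    rw [this, normalizedVal_unit_mul_zpow ht, WithTop.coe_le_coe]
    omega

theorem normalizedVal_eq_top_iff {x : FractionRing A} : normalizedVal x = ⊤ ↔ x = 0 := by
  obtain ⟨t, ht⟩ := IsDiscreteValuationRing.exists_irreducible (integralClosure A (FractionRing A))
  refine ⟨fun h => ?_, fun h => h ▸ normalizedVal_zero⟩
  by_contra hx
  obtain ⟨e, m, rfl⟩ := exists_eq_unit_mul_zpow ht hx
  rw [normalizedVal_unit_mul_zpow ht] at h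
  exact WithTop.coe_ne_top h

theorem normalizedVal_mul (x y : FractionRing A) :
    normalizedVal (x * y) = normalizedVal x + normalizedVal y := by
  obtain ⟨t, ht⟩ := IsDiscreteValuationRing.exists_irreducible (integralClosure A (FractionRing A))
  have ht0 : (t : FractionRing A) ≠ 0 := fun h0 => ht.ne_zero (Subtype.ext h0)
  by_cases hx : x = 0
  · rw [hx, zero_mul, normalizedVal_zero, WithTop.top_add]
  by_cases hy : y = 0
  · rw [hy, mul_zero, normalizedVal_zero, WithTop.add_top]
  obtain ⟨e, m, rfl⟩ := exists_eq_unit_mul_zpow ht hx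
  obtain ⟨f, n, rfl⟩ := exists_eq_unit_mul_zpow ht hy
  rw [normalizedVal_unit_mul_zpow ht, normalizedVal_unit_mul_zpow ht, ← WithTop.coe_add,
    ← normalizedVal_unit_mul_zpow ht (e * f), zpow_add₀ ht0, Units.val_mul, Subalgebra.coe_mul]
  congr 1
  ring

theorem normalizedVal_integral_nonneg (b : integralClosure A (FractionRing A)) :
    0 ≤ normalizedVal (b : FractionRing A) := by
  obtain ⟨t, ht⟩ := IsDiscreteValuationRing.exists_irreducible (integralClosure A (FractionRing A))
  exact (le_normalizedVal_iff ht (n := 0)).mpr ⟨b, by simp⟩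

theorem min_le_normalizedVal_add (x y : FractionRing A) :
    min (normalizedVal x) (normalizedVal y) ≤ normalizedVal (x + y) := by
  obtain ⟨t, ht⟩ := IsDiscreteValuationRing.exists_irreducible (integralClosure A (FractionRing A))
  by_cases h : min (normalizedVal x) (normalizedVal y) = ⊤
  · obtain ⟨h1, h2⟩ := min_eq_top.mp h
    rw [normalizedVal_eq_top_iff] at h1 h2
    rw [h1, h2, add_zero, normalizedVal_zero]
    exact le_top
  · obtain ⟨n, hn⟩ := WithTop.ne_top_iff_exists.mp h
    obtain ⟨b, hb⟩ := (le_normalizedVal_iff ht).mp (hn.le.trans (min_le_left _ _))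
    obtain ⟨c, hc⟩ := (le_normalizedVal_iff ht).mp (hn.le.trans (min_le_right _ _))
    rw [← hn, le_normalizedVal_iff ht]
    exact ⟨b + c, by rw [hb, hc, Subalgebra.coe_add]; ring⟩

/-- Two elements of the same order differ by a constant factor up to terms of higher order, if the
constants `c` fill the residue field. -/
theorem exists_lt_normalizedVal_sub {ι : Type*} (c : ι → integralClosure A (FractionRing A))
    (hc : ∀ x, ∃ i, x - c i ∈ IsLocalRing.maximalIdeal (integralClosure A (FractionRing A)))
    {x y : FractionRing A} (h : normalizedVal x = normalizedVal y) (hy : normalizedVal y ≠ ⊤) :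
    ∃ i, normalizedVal y < normalizedVal (x - (c i : FractionRing A) * y) := by
  obtain ⟨t, ht⟩ := IsDiscreteValuationRing.exists_irreducible (integralClosure A (FractionRing A))
  have ht0 : (t : FractionRing A) ≠ 0 := fun h0 => ht.ne_zero (Subtype.ext h0)
  have hx0 : x ≠ 0 := fun h0 => hy (by rw [← h, h0, normalizedVal_zero])
  have hy0 : y ≠ 0 := fun h0 => hy (by rw [h0, normalizedVal_zero])
  obtain ⟨e, m, rfl⟩ := exists_eq_unit_mul_zpow ht hx0
  obtain ⟨f, n, rfl⟩ := exists_eq_unit_mul_zpow ht hy0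
  rw [normalizedVal_unit_mul_zpow ht, normalizedVal_unit_mul_zpow ht, WithTop.coe_inj] at h
  subst h
  -- The required constant is the residue of the quotient of the unit parts.
  obtain ⟨i, hi⟩ := hc ((e * f⁻¹ : (integralClosure A (FractionRing A))ˣ) :
    integralClosure A (FractionRing A))
  refine ⟨i, ?_⟩
  rw [ht.maximalIdeal_eq, Ideal.mem_span_singleton'] at hi
  obtain ⟨b, hb⟩ := hi
  have h1 : (e : integralClosure A (FractionRing A)) - c i * f = b * f * t := by
    have : (e : integralClosure A (FractionRing A)) = (e * f⁻¹ : (integralClosure A (FractionRing A))ˣ) * f := by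
      rw [← Units.val_mul, inv_mul_cancel_right]
    rw [this, ← sub_mul, ← hb]
    ring
  rw [normalizedVal_unit_mul_zpow ht]
  refine (WithTop.coe_lt_coe.mpr (lt_add_one m)).trans_le ((le_normalizedVal_iff ht).mpr ⟨b * f, ?_⟩)
  have h2 := congrArg Subtype.val h1
  simp only [Subalgebra.coe_mul, AddSubgroupClass.coe_sub] at h2
  rw [zpow_add₀ ht0, zpow_one, Subalgebra.coe_mul]
  linear_combination (t : FractionRing A) ^ m * h2

end NormalizedVal

/-- An order function on a module over a `k`-algebra `R`, with residue field `k`. -/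
structure IsOrderFunction (k : Type*) {R M : Type*} [Field k] [CommRing R] [Algebra k R]
    [AddCommGroup M] [Module R M] (w : M → WithTop ℤ) : Prop where
  map_zero : w 0 = ⊤
  min_le_map_add : ∀ x y, min (w x) (w y) ≤ w (x + y)
  le_map_smul : ∀ (a : R) x, w x ≤ w (a • x)
  exists_lt_map_sub : ∀ x y, w x = w y → w y ≠ ⊤ →
    ∃ c : k, w y < w (x - algebraMap k R c • y)

theorem IsOrderFunction.comp {k R M M' : Type*} [Field k] [CommRing R] [Algebra k R]
    [AddCommGroup M] [Module R M] [AddCommGroup M'] [Module R M'] {w : M → WithTop ℤ}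
    (hw : IsOrderFunction k (R := R) w) (f : M' →ₗ[R] M) :
    IsOrderFunction k (R := R) (fun x => w (f x)) where
  map_zero := by rw [_root_.map_zero, hw.map_zero]
  min_le_map_add x y := by rw [map_add]; exact hw.min_le_map_add _ _
  le_map_smul a x := by rw [map_smul]; exact hw.le_map_smul _ _
  exists_lt_map_sub x y h hy := by
    obtain ⟨c, hc⟩ := hw.exists_lt_map_sub _ _ h hy
    exact ⟨c, by rwa [map_sub, map_smul]⟩

/-! ### The branch valuations are order functions -/

section Branch

variable {k O : Type*} [Field k] [CommRing O] [Algebra k O]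

theorem isLocalRing_branch (hO : IsCurveRing k O) (q : minimalPrimes O) :
    IsLocalRing (integralClosure (O ⧸ q.1) (BranchField q)) := by
  have := hO.toIsLocalRing
  have := hO.toIsNoetherian
  have := hO.complete
  have : Algebra.IsIntegral O (integralClosure (O ⧸ q.1) (BranchField q)) :=
    Algebra.IsIntegral.trans (O ⧸ q.1)
  exact isLocalRing_of_isIntegral (R := O) _

theorem isDiscreteValuationRing_branch (hO : IsCurveRing k O) (q : minimalPrimes O) :
    IsDiscreteValuationRing (integralClosure (O ⧸ q.1) (BranchField q)) := by
  have := hO.toIsNoetherian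
  have := isLocalRing_branch hO q
  exact isDiscreteValuationRing_normalization (hO.pureDimOne q.1 q.2)

theorem branchVal_eq_top_iff (hO : IsCurveRing k O) (q : minimalPrimes O) {x : BranchField q} :
    branchVal q x = ⊤ ↔ x = 0 :=
  have := isDiscreteValuationRing_branch hO q
  normalizedVal_eq_top_iff

theorem branchVal_mul (hO : IsCurveRing k O) (q : minimalPrimes O) (x y : BranchField q) :
    branchVal q (x * y) = branchVal q x + branchVal q y :=
  have := isDiscreteValuationRing_branch hO q
  normalizedVal_mul x y

theorem branchVal_algebraMap_nonneg (hO : IsCurveRing k O) (q : minimalPrimes O) (a : O) :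
    0 ≤ branchVal q (algebraMap O (BranchField q) a) :=
  have := isDiscreteValuationRing_branch hO q
  normalizedVal_integral_nonneg (algebraMap O (integralClosure (O ⧸ q.1) (BranchField q)) a)

theorem isOrderFunction_branchVal (hO : IsCurveRing k O) (q : minimalPrimes O) :
    IsOrderFunction k (R := O) (branchVal q) where
  map_zero := normalizedVal_zero
  min_le_map_add x y :=
    have := isDiscreteValuationRing_branch hO q
    min_le_normalizedVal_add x y
  le_map_smul a x := by
    rw [Algebra.smul_def, branchVal_mul hO]
    exact le_add_of_nonneg_left (branchVal_algebraMap_nonneg hO q a)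
  exists_lt_map_sub x y h hy := by
    have := hO.isAlgClosed
    have := hO.toIsLocalRing
    have := isDiscreteValuationRing_branch hO q
    have : Algebra.IsIntegral O (integralClosure (O ⧸ q.1) (BranchField q)) :=
      Algebra.IsIntegral.trans (O ⧸ q.1)
    obtain ⟨c, hc⟩ := exists_lt_normalizedVal_sub
      (fun c : k => algebraMap O (integralClosure (O ⧸ q.1) (BranchField q)) (algebraMap k O c))
      (exists_sub_algebraMap_mem_maximalIdeal hO.coefficientField) h hy
    refine ⟨c, ?_⟩
    rw [Algebra.smul_def]
    exact hc

end Branch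

end AlgebroidCurve

namespace AlgebroidCurve

/-! ### Order functions: lengths, exchange, thresholds -/

section Order

variable {k R M : Type*} [Field k] [CommRing R] [Algebra k R] [AddCommGroup M] [Module R M]

theorem coe_sub_one_lt_iff {n : ℤ} {x : WithTop ℤ} :
    ((n - 1 : ℤ) : WithTop ℤ) < x ↔ (n : WithTop ℤ) ≤ x := by
  induction x with
  | top => exact iff_of_true (WithTop.coe_lt_top _) le_top
  | coe x => rw [WithTop.coe_lt_coe, WithTop.coe_le_coe]; omega

theorem coe_add_one_le_iff {n : ℤ} {x : WithTop ℤ} :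
    ((n + 1 : ℤ) : WithTop ℤ) ≤ x ↔ (n : WithTop ℤ) < x := by
  rw [← coe_sub_one_lt_iff, add_sub_cancel_right]

namespace IsOrderFunction

variable {w : M → WithTop ℤ}

theorem map_neg (hw : IsOrderFunction k (R := R) w) (x : M) : w (-x) = w x := by
  have h : ∀ x, w x ≤ w (-x) := fun x => by simpa using hw.le_map_smul (-1) x
  exact le_antisymm (by simpa using h (-x)) (h x)

theorem min_le_map_sub (hw : IsOrderFunction k (R := R) w) (x y : M) :
    min (w x) (w y) ≤ w (x - y) := by
  rw [sub_eq_add_neg, ← hw.map_neg y]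
  exact hw.min_le_map_add _ _

theorem map_const_smul (hw : IsOrderFunction k (R := R) w) {c : k} (hc : c ≠ 0) (x : M) :
    w (algebraMap k R c • x) = w x := by
  refine le_antisymm ?_ (hw.le_map_smul _ _)
  have := hw.le_map_smul (algebraMap k R c⁻¹) (algebraMap k R c • x)
  rwa [smul_smul, ← map_mul, inv_mul_cancel₀ hc, map_one, one_smul] at this

theorem map_add_of_lt (hw : IsOrderFunction k (R := R) w) {x y : M} (h : w x < w y) :
    w (x + y) = w x := by
  refine le_antisymm ?_ ((min_eq_left h.le).ge.trans (hw.min_le_map_add x y))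
  by_contra! hlt
  have := hw.min_le_map_sub (x + y) y
  rw [add_sub_cancel_right] at this
  exact this.not_gt (lt_min hlt h)

theorem map_sub_of_lt (hw : IsOrderFunction k (R := R) w) {x y : M} (h : w x < w y) :
    w (x - y) = w x := by
  rw [sub_eq_add_neg, hw.map_add_of_lt (by rwa [hw.map_neg])]

theorem map_sub_of_ne (hw : IsOrderFunction k (R := R) w) {x y : M} (h : w x ≠ w y) :
    w (x - y) = min (w x) (w y) := by
  rcases h.lt_or_gt with h | h
  · rw [hw.map_sub_of_lt h, min_eq_left h.le]
  · rw [← neg_sub, hw.map_neg, hw.map_sub_of_lt h, min_eq_right h.le]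

/-- The elements of order at least `a`. -/
def submodule (hw : IsOrderFunction k (R := R) w) (a : ℤ) : Submodule R M where
  carrier := {x | (a : WithTop ℤ) ≤ w x}
  zero_mem' := by
    rw [Set.mem_ofPred_eq, hw.map_zero]
    exact le_top
  add_mem' hx hy := (le_min hx hy).trans (hw.min_le_map_add _ _)
  smul_mem' c x hx := le_trans hx (hw.le_map_smul c x)

/-- Any element of exact order `a` generates the quotient, because a constant multiple of it cancels
the leading term of any other. -/
theorem colength_submodule_add_one (hw : IsOrderFunction k (R := R) w) (P : Submodule R M) (a : ℤ)
    [Decidable (∃ h ∈ P, w h = a)] :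
    colength (P ⊓ hw.submodule a) (P ⊓ hw.submodule (a + 1)) = if ∃ h ∈ P, w h = a then 1 else 0 := by
  have key : ∀ y ∈ P ⊓ hw.submodule a, y ∉ P ⊓ hw.submodule (a + 1) → w y = a := by
    intro y hy hy'
    refine le_antisymm ?_ hy.2
    by_contra! h
    exact hy' ⟨hy.1, coe_add_one_le_iff.mpr h⟩
  split_ifs with h
  · obtain ⟨h, hP, hh⟩ := h
    refine colength_eq_one (fun hle => ?_) fun x hx y hy hy' => ?_
    · have : ((a + 1 : ℤ) : WithTop ℤ) ≤ w h := (hle ⟨hP, hh.ge⟩).2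
      rw [coe_add_one_le_iff, hh] at this
      exact lt_irrefl _ this
    · by_cases hx' : x ∈ P ⊓ hw.submodule (a + 1)
      · exact ⟨0, by rwa [zero_smul, sub_zero]⟩
      · have h1 := key x hx hx'
        have h2 := key y hy hy'
        obtain ⟨c, hc⟩ := hw.exists_lt_map_sub x y (h1.trans h2.symm) (h2 ▸ WithTop.coe_ne_top)
        refine ⟨algebraMap k R c, P.sub_mem hx.1 (P.smul_mem _ hy.1), ?_⟩
        rwa [h2, ← coe_add_one_le_iff] at hc
  · rw [colength_eq_zero_iff]
    intro x hx
    by_contra hx'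
    exact h ⟨x, hx.1, key x hx hx'⟩

open Classical in
theorem colength_submodule (hw : IsOrderFunction k (R := R) w) (P : Submodule R M) {a b : ℤ}
    (hab : a ≤ b) : colength (P ⊓ hw.submodule a) (P ⊓ hw.submodule b) =
      ((Finset.Ico a b).filter fun c : ℤ => ∃ h ∈ P, w h = c).card := by
  have hmono : ∀ {a b : ℤ}, a ≤ b → P ⊓ hw.submodule b ≤ P ⊓ hw.submodule a := fun hab =>
    inf_le_inf_left P fun x hx => (WithTop.coe_le_coe.mpr hab).trans hx
  induction b, hab using Int.leInduction with
  | base => simp [colength_eq_zero_iff]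
  | succ b hab ih =>
    rw [colength_eq_add (hmono (Int.le_add_one le_rfl)) (hmono hab), ih, colength_submodule_add_one,
      ← Finset.insert_Ico_right_eq_Ico_add_one hab, Finset.filter_insert]
    split_ifs with h
    · rw [Finset.card_insert_of_notMem (by simp), Nat.cast_add_one]
    · rw [add_zero]

end IsOrderFunction

variable {ι : Type*} {w : ι → M → WithTop ℤ}

/-- Take `z = x - cy` with `c` cancelling the leading term at `i`. This `c` is nonzero, so `cy` has
the orders of `y` everywhere. -/
theorem exists_exchange (hw : ∀ i, IsOrderFunction k (R := R) (w i)) {N : Submodule R M} {x y : M}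
    (hx : x ∈ N) (hy : y ∈ N) {i : ι} (h : w i x = w i y) (hi : w i y ≠ ⊤) :
    ∃ z ∈ N, w i y < w i z ∧ (∀ j, min (w j x) (w j y) ≤ w j z) ∧
      ∀ j, w j x ≠ w j y → w j z = min (w j x) (w j y) := by
  obtain ⟨c, hc⟩ := (hw i).exists_lt_map_sub x y h hi
  have hc0 : c ≠ 0 := by
    rintro rfl
    rw [_root_.map_zero, zero_smul, sub_zero, h] at hc
    exact lt_irrefl _ hc
  refine ⟨x - algebraMap k R c • y, N.sub_mem hx (N.smul_mem _ hy), hc, fun j => ?_, fun j hj => ?_⟩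
  · rw [← (hw j).map_const_smul hc0 y]
    exact (hw j).min_le_map_sub _ _
  · rw [← (hw j).map_const_smul hc0 y] at hj ⊢
    exact (hw j).map_sub_of_ne hj

/-- A general combination `x + cy` works: at each place at most one nonzero `c` fails, since two
failures would put both `x` and `y` above their minimum. Finitely many bad constants do not exhaust
`k`. -/
theorem exists_eq_min [Finite ι] [Infinite k] (hw : ∀ i, IsOrderFunction k (R := R) (w i))
    {N : Submodule R M} {x y : M} (hx : x ∈ N) (hy : y ∈ N) :
    ∃ z ∈ N, ∀ i, w i z = min (w i x) (w i y) := by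
  let bad : ι → Set k := fun i =>
    {c | c ≠ 0 ∧ w i (x + algebraMap k R c • y) ≠ min (w i x) (w i y)}
  have hbad : ∀ i, (bad i).Subsingleton := by
    intro i c hc d hd
    by_contra hcd
    have hlt : ∀ c ∈ bad i, min (w i x) (w i y) < w i (x + algebraMap k R c • y) := fun c hc => by
      refine lt_of_le_of_ne ?_ hc.2.symm
      rw [← (hw i).map_const_smul hc.1 y]
      exact (hw i).min_le_map_add _ _
    have h1 := lt_min (hlt c hc) (hlt d hd)
    have h2 : min (w i x) (w i y) < w i y := by
      have := h1.trans_le ((hw i).min_le_map_sub _ _)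
      rwa [add_sub_add_left_eq_sub, ← sub_smul, ← map_sub,
        (hw i).map_const_smul (sub_ne_zero.mpr hcd)] at this
    have h3 : min (w i x) (w i y) < w i x := by
      have := (lt_min (hlt c hc) (h2.trans_eq ((hw i).map_const_smul hc.1 y).symm)).trans_le
        ((hw i).min_le_map_sub _ _)
      rwa [add_sub_cancel_right] at this
    exact lt_irrefl _ (lt_min h3 h2)
  obtain ⟨c, hc⟩ := ((Set.finite_iUnion fun i => (hbad i).finite).union
    (Set.finite_singleton (0 : k))).exists_notMem
  refine ⟨x + algebraMap k R c • y, N.add_mem hx (N.smul_mem _ hy), fun i => ?_⟩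
  by_contra h
  refine hc (or_iff_not_imp_right.mpr fun h0 => ?_)
  exact Set.mem_iUnion.mpr ⟨i, h0, h⟩

theorem exists_eq_finset_inf [Finite ι] [Infinite k] (hw : ∀ i, IsOrderFunction k (R := R) (w i))
    {N : Submodule R M} {σ : Type*} (s : Finset σ) (f : σ → M) (hf : ∀ a ∈ s, f a ∈ N) :
    ∃ z ∈ N, ∀ i, w i z = s.inf fun a => w i (f a) := by
  classical
  induction s using Finset.induction_on with
  | empty => exact ⟨0, N.zero_mem, fun i => by simp [(hw i).map_zero]⟩
  | insert a s ha ih =>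
    obtain ⟨y, hy, h⟩ := ih fun b hb => hf b (Finset.mem_insert_of_mem hb)
    obtain ⟨z, hz, h'⟩ := exists_eq_min hw (hf a (Finset.mem_insert_self a s)) hy
    exact ⟨z, hz, fun i => by rw [h', h, Finset.inf_insert]⟩

/-- Some element of `N` has order `a` at the place `s` and orders above `t` at the others. -/
def Reaches (w : ι → M → WithTop ℤ) (N : Submodule R M) (s : ι) (a : ℤ) (t : ι → ℤ) : Prop :=
  ∃ h ∈ N, w s h = a ∧ ∀ i ≠ s, (t i : WithTop ℤ) < w i h

theorem Reaches.mono {N : Submodule R M} {s : ι} {a : ℤ} {t t' : ι → ℤ} (h : Reaches w N s a t)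
    (ht : ∀ i ≠ s, t' i ≤ t i) : Reaches w N s a t' := by
  obtain ⟨x, hx, hs, h⟩ := h
  exact ⟨x, hx, hs, fun i hi => (WithTop.coe_le_coe.mpr (ht i hi)).trans_lt (h i hi)⟩

/-- Take `t` minimal among the unreached thresholds in the box. Lowering `t i` by one makes it
reachable, and the witness must have order exactly `t i` at `i`, or it would reach `t`. -/
theorem exists_minimal_not_reaches [Finite ι] {N : Submodule R M} {s : ι} {a : ℤ} {t₀ t₁ : ι → ℤ}
    (h : t₀ ≤ t₁) (h₀ : Reaches w N s a t₀) (h₁ : ¬ Reaches w N s a t₁) :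
    ∃ t, t₀ ≤ t ∧ ¬ Reaches w N s a t ∧ (∃ i ≠ s, t₀ i < t i) ∧ ∀ i ≠ s, t₀ i < t i →
      ∃ x ∈ N, w s x = a ∧ w i x = t i ∧ ∀ j ≠ s, j ≠ i → (t j : WithTop ℤ) < w j x := by
  classical
  have := Fintype.ofFinite ι
  obtain ⟨t, ⟨⟨ht, hbad⟩, hmin⟩⟩ := ((Set.finite_Icc t₀ t₁).inter_of_left
    {t | ¬ Reaches w N s a t}).exists_minimal ⟨t₁, ⟨h, le_rfl⟩, h₁⟩
  refine ⟨t, ht.1, hbad, ?_, fun i hi hti => ?_⟩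
  · by_contra! hcon
    exact hbad (h₀.mono hcon)
  · have hlt : Function.update t i (t i - 1) ≤ t := by
      rw [update_le_self_iff]
      omega
    have hge : t₀ ≤ Function.update t i (t i - 1) := by
      rw [le_update_iff]
      exact ⟨by omega, fun j _ => ht.1 j⟩
    have hgood : Reaches w N s a (Function.update t i (t i - 1)) := by
      by_contra hcon
      have := hmin ⟨⟨hge, hlt.trans ht.2⟩, hcon⟩ hlt i
      simp at this
    obtain ⟨x, hx, hxs, hxt⟩ := hgood
    have hj : ∀ j ≠ s, j ≠ i → (t j : WithTop ℤ) < w j x := fun j hjs hji => by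
      simpa [hji] using hxt j hjs
    refine ⟨x, hx, hxs, le_antisymm ?_ ?_, hj⟩
    · by_contra! hcon
      refine hbad ⟨x, hx, hxs, fun j hjs => ?_⟩
      by_cases hji : j = i
      · exact hji ▸ hcon
      · exact hj j hjs hji
    · have := hxt i hi
      rwa [Function.update_self, coe_sub_one_lt_iff] at this

variable {N : Submodule R M} {γ : ι → ℤ}

/-- Adding an element of large order makes infinite orders finite and leaves the finite ones alone.
-/
theorem exists_add_of_conductor (hw : ∀ i, IsOrderFunction k (R := R) (w i))
    (hγ : ∀ β, γ ≤ β → ∃ g ∈ N, ∀ i, w i g = β i) {x : M} (hx : x ∈ N) (B : ι → ℤ) :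
    ∃ y ∈ N, ∀ i, ∃ n : ℤ, w i y = n ∧ (w i x = n ∨ w i x = ⊤ ∧ B i ≤ n) := by
  -- The default 0 is harmless: where `x` has infinite order, any finite order of `g` is smaller.
  obtain ⟨g, hg, h⟩ := hγ (fun i => max (γ i) (max (B i) ((w i x).untopD 0 + 1)))
    fun i => le_max_left _ _
  refine ⟨x + g, N.add_mem hx hg, fun i => ?_⟩
  have hi := h i
  by_cases hxi : w i x = ⊤
  · refine ⟨_, ?_, Or.inr ⟨hxi, (le_max_left (B i) ((w i x).untopD 0 + 1)).trans (le_max_right (γ i) _)⟩⟩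
    rw [add_comm, (hw i).map_add_of_lt (by rw [hxi, hi]; exact WithTop.coe_lt_top _), hi]
  · obtain ⟨n, hn⟩ := WithTop.ne_top_iff_exists.mp hxi
    refine ⟨n, ?_, Or.inl hn.symm⟩
    rw [(hw i).map_add_of_lt, hn]
    rw [hi, ← hn, WithTop.coe_lt_coe, WithTop.untopD_coe]
    exact (lt_add_one n).trans_le ((le_max_right _ _).trans (le_max_right _ _))

/-- A minimal unreached `t` above `γ - 1` would have some `t i ≥ γ i`, and an element `x` failing
only at `i`, with order exactly `t i`. Exchanging `x` at `i` with an element supplied by the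
conductor repairs this. -/
theorem Reaches.of_conductor [Finite ι] (hw : ∀ i, IsOrderFunction k (R := R) (w i))
    (hγ : ∀ β, γ ≤ β → ∃ g ∈ N, ∀ i, w i g = β i) {s : ι} {a : ℤ}
    (h : Reaches w N s a fun i => γ i - 1) (t : ι → ℤ) : Reaches w N s a t := by
  classical
  by_contra hcon
  obtain ⟨t, hle, hbad, ⟨i, his, hti⟩, hx⟩ := exists_minimal_not_reaches
    (t₁ := fun i => max (t i) (γ i - 1)) (fun i => le_max_right _ _) h
    fun h' => hcon (h'.mono fun i _ => le_max_left _ _)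
  obtain ⟨x, hxN, hxs, hxi, hxj⟩ := hx i his hti
  -- `g` agrees with `x` in order at `i`, exceeds `a` at `s` so that the order `a` survives, and
  -- exceeds `t` elsewhere.
  obtain ⟨g, hgN, hg⟩ := hγ (fun j => if j = i then t i else if j = s then max (γ s) (a + 1) else
    t j + 1) fun j => by
      have := hle j
      dsimp only at this ⊢
      split_ifs with h1 h2
      · subst h1
        omega
      · subst h2
        exact le_max_left _ _
      · omega
  have hgi := hg i
  have hgs := hg s
  simp only [if_true] at hgi
  rw [if_neg his.symm, if_pos rfl] at hgs
  obtain ⟨z, hzN, hz1, hz2, hz3⟩ := exists_exchange hw hxN hgN (hxi.trans hgi.symm)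
    (hgi ▸ WithTop.coe_ne_top)
  have hlt : w s x < w s g := by
    rw [hxs, hgs, WithTop.coe_lt_coe]
    exact (lt_add_one a).trans_le (le_max_right _ _)
  refine hbad ⟨z, hzN, ?_, fun j hjs => ?_⟩
  · rw [hz3 s hlt.ne, min_eq_left hlt.le, hxs]
  · by_cases hji : j = i
    · subst hji
      rwa [hgi] at hz1
    · refine (lt_min (hxj j hjs hji) ?_).trans_le (hz2 j)
      rw [hg j, if_neg hji, if_neg hjs, WithTop.coe_lt_coe]
      exact lt_add_one _

/-- The value set of `N` at the places in `J`. -/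
def valuesOn (w : ι → M → WithTop ℤ) (N : Submodule R M) (J : Finset ι) : Set (J → ℤ) :=
  {α | ∃ h ∈ N, ∀ j : J, w j h = α j}

/-- Points of a fiber have finite coordinates, but witnesses may have zero components: the conductor
perturbs these to finite orders above `α`. -/
theorem fiberOver_valuesOn_nonempty_iff (hw : ∀ i, IsOrderFunction k (R := R) (w i))
    (hγ : ∀ β, γ ≤ β → ∃ g ∈ N, ∀ i, w i g = β i) {J : Finset ι} {A : Set J} {α : J → ℤ} :
    (fiberOver (valuesOn w N J) A α).Nonempty ↔
      ∃ h ∈ N, ∀ j : J, (j ∈ A → w j h = α j) ∧ (j ∉ A → (α j : WithTop ℤ) < w j h) := by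
  classical
  constructor
  · rintro ⟨β, ⟨h, hN, hβ⟩, h1, h2⟩
    exact ⟨h, hN, fun j => ⟨fun hj => by rw [hβ, h1 j hj],
      fun hj => by rw [hβ, WithTop.coe_lt_coe]; exact h2 j hj⟩⟩
  · rintro ⟨h, hN, hh⟩
    obtain ⟨y, hyN, hy⟩ := exists_add_of_conductor hw hγ hN
      fun i => if hi : i ∈ J then α ⟨i, hi⟩ + 1 else 0
    choose β hβ hβ' using hy
    refine ⟨fun j => β j, ⟨y, hyN, fun j => hβ j⟩, fun j hj => ?_, fun j hj => ?_⟩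
    · have h1 := (hh j).1 hj
      rcases hβ' j with h2 | ⟨h2, -⟩
      · exact WithTop.coe_inj.mp (h2.symm.trans h1)
      · exact absurd (h2.symm.trans h1) WithTop.top_ne_coe
    · rcases hβ' j with h2 | ⟨-, h2⟩
      · have h1 := (hh j).2 hj
        rwa [h2, WithTop.coe_lt_coe] at h1
      · rw [dif_pos j.2] at h2
        exact h2

end Order

end AlgebroidCurve

namespace AlgebroidCurve

/-! ### Missed values are coordinates of relative maximals -/

section RelativeMaximals

variable {k R M : Type*} [Field k] [CommRing R] [Algebra k R] [AddCommGroup M] [Module R M]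
  {ι : Type*} {w : ι → M → WithTop ℤ} {N : Submodule R M} {γ m : ι → ℤ}

/-- The coordinates at the place `s` of the relative maximals of the value sets of `N` at the sets
of places that contain `s` strictly. -/
def relMaxCoords (w : ι → M → WithTop ℤ) (N : Submodule R M) (s : ι) : Set ℤ :=
  {a | ∃ (J : Finset ι) (hs : s ∈ J), J ≠ {s} ∧
    ∃ β ∈ relativeMaximals (valuesOn w N J), β ⟨s, hs⟩ = a}

theorem natCard_ne_one {J : Finset ι} {s : ι} (hs : s ∈ J) (hJ : J ≠ {s}) : Nat.card J ≠ 1 := by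
  rw [Nat.card_eq_fintype_card, Fintype.card_coe]
  intro h
  obtain ⟨x, rfl⟩ := Finset.card_eq_one.mp h
  rw [Finset.mem_singleton] at hs
  exact hJ (by rw [hs])

theorem exists_of_mem_relMaxCoords {s : ι} {a : ℤ} (h : a ∈ relMaxCoords w N s) :
    ∃ x ∈ N, w s x = a := by
  obtain ⟨J, hs, hJ, β, ⟨hβ, -⟩, rfl⟩ := h
  rcases hβ with ⟨h, -⟩ | ⟨-, ⟨x, hx, h⟩, -⟩
  · exact absurd h (natCard_ne_one hs hJ)
  · exact ⟨x, hx, h ⟨s, hs⟩⟩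

/-- Otherwise some element has order `a` at `s` and exceeds `β` at the rest of `J`, giving a point
of the fiber that maximality declares empty. -/
theorem not_reaches_of_mem_relMaxCoords [Finite ι] (hw : ∀ i, IsOrderFunction k (R := R) (w i))
    (hγ : ∀ β, γ ≤ β → ∃ g ∈ N, ∀ i, w i g = β i) {s : ι} {a : ℤ} (h : a ∈ relMaxCoords w N s) :
    ¬ Reaches w N s a fun i => γ i - 1 := by
  classical
  intro hr
  obtain ⟨J, hs, hJ, β, ⟨hβ, -⟩, rfl⟩ := h
  rcases hβ with ⟨h, -⟩ | ⟨-, -, h⟩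
  · exact absurd h (natCard_ne_one hs hJ)
  · obtain ⟨x, hx, hxs, hxi⟩ := hr.of_conductor hw hγ fun i => if hi : i ∈ J then β ⟨i, hi⟩ else 0
    obtain ⟨y, hy⟩ := (fiberOver_valuesOn_nonempty_iff hw hγ (A := {⟨s, hs⟩}) (α := β)).mpr
      ⟨x, hx, fun j => ⟨fun hj => by rw [Set.mem_singleton_iff.mp hj, hxs], fun hj => by
        have := hxi j fun h => hj (Subtype.ext h)
        dsimp only at this
        rwa [dif_pos j.2] at this⟩⟩
    have : y ∈ fiber (valuesOn w N J) β := Set.mem_iUnion.mpr ⟨_, hy⟩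
    rw [h] at this
    exact this

/-- A minimal unreached `t` between `m - 1` and `γ - 1` yields the relative maximal `β`, equal to
`a` at `s` and to `t` elsewhere on `J`. Minimality supplies, for each `i ≠ s` in `J`, an element `f
i` of orders `a` at `s`, `t i` at `i` and above `t` at the other places. Minima and exchanges of the
`f i` fill all fibers over two or more places. -/
theorem mem_relMaxCoords_of_not_reaches [Finite ι] [Infinite k]
    (hw : ∀ i, IsOrderFunction k (R := R) (w i))
    (hγ : ∀ β, γ ≤ β → ∃ g ∈ N, ∀ i, w i g = β i) (hm : ∀ x ∈ N, ∀ i, (m i : WithTop ℤ) ≤ w i x)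
    {s : ι} {a : ℤ} (ha : ∃ x ∈ N, w s x = a) (hr : ¬ Reaches w N s a fun i => γ i - 1) :
    a ∈ relMaxCoords w N s := by
  classical
  have := Fintype.ofFinite ι
  have hmγ : m ≤ γ := fun i => by
    obtain ⟨g, hg, h⟩ := hγ γ le_rfl
    exact WithTop.coe_le_coe.mp ((hm g hg i).trans_eq (h i))
  have h₀ : Reaches w N s a fun i => m i - 1 := by
    obtain ⟨x, hx, hxs⟩ := ha
    exact ⟨x, hx, hxs, fun i _ => coe_sub_one_lt_iff.mpr (hm x hx i)⟩
  obtain ⟨t, hle, hbad, ⟨i₀, hi₀, hti₀⟩, hx⟩ :=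
    exists_minimal_not_reaches (fun i => sub_le_sub_right (hmγ i) 1) h₀ hr
  -- Putting the hypotheses after the witness makes `f` total; its value 0 elsewhere is never used.
  have hx' : ∀ i, ∃ x, i ≠ s → m i ≤ t i → x ∈ N ∧ w s x = a ∧ w i x = t i ∧
      ∀ j ≠ s, j ≠ i → (t j : WithTop ℤ) < w j x := fun i => by
    by_cases hi : i ≠ s ∧ m i ≤ t i
    · obtain ⟨x, h⟩ := hx i hi.1 (by have := hi.2; omega)
      exact ⟨x, fun _ _ => h⟩
    · exact ⟨0, fun h1 h2 => absurd ⟨h1, h2⟩ hi⟩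
  choose f hf using hx'
  -- The places left out have `t i = m i - 1`, a threshold that every element of `N` exceeds.
  let J : Finset ι := Finset.univ.filter fun i => i ≠ s → m i ≤ t i
  have hsJ : s ∈ J := by simp [J]
  have hJ : ∀ {i}, i ∈ J → i ≠ s → m i ≤ t i := fun hi => (Finset.mem_filter.mp hi).2
  have hi₀J : i₀ ∈ J := by
    simp only [J, Finset.mem_filter, Finset.mem_univ, true_and]
    omega
  have hJs : J ≠ {s} := fun h => hi₀ (by rwa [h, Finset.mem_singleton] at hi₀J)
  have hfs : ∀ j ∈ J, ∀ i ∈ J, j ≠ s → i ≠ s → (t j : WithTop ℤ) ≤ w j (f i) := by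
    intro j hj i hi hjs his
    obtain ⟨-, -, h1, h2⟩ := hf i his (hJ hi his)
    by_cases hji : j = i
    · rw [hji, h1]
    · exact (h2 j hjs hji).le
  let β : J → ℤ := fun j => if (j : ι) = s then a else t j
  have hβs : ∀ j : J, (j : ι) = s → β j = a := fun j hj => if_pos hj
  have hβ : ∀ j : J, (j : ι) ≠ s → β j = t j := fun j hj => if_neg hj
  have hno : ∀ x ∈ N, w s x = a → ∃ j : J, (j : ι) ≠ s ∧ w j x ≤ t j := by
    intro x hxN hxs
    by_contra! hcon
    refine hbad ⟨x, hxN, hxs, fun i hi => ?_⟩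
    by_cases hiJ : i ∈ J
    · exact hcon ⟨i, hiJ⟩ hi
    · simp only [J, Finset.mem_filter, Finset.mem_univ, true_and, Classical.not_imp, not_le] at hiJ
      exact (WithTop.coe_lt_coe.mpr hiJ.2).trans_le (hm x hxN i)
  have hinf : ∀ S : Finset ι, S ⊆ J → s ∉ S → S.Nonempty → ∃ y ∈ N, w s y = a ∧
      (∀ j ∈ S, w j y = t j) ∧ ∀ j ∈ J, j ≠ s → j ∉ S → (t j : WithTop ℤ) < w j y := by
    intro S hSJ hsS hne
    have hS : ∀ i ∈ S, i ≠ s := fun i hi h => hsS (h ▸ hi)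
    obtain ⟨y, hyN, hy⟩ := exists_eq_finset_inf hw S f
      fun i hi => (hf i (hS i hi) (hJ (hSJ hi) (hS i hi))).1
    refine ⟨y, hyN, ?_, fun j hj => ?_, fun j hjJ hjs hjS => ?_⟩
    · rw [hy, ← Finset.inf_const hne (a : WithTop ℤ)]
      exact Finset.inf_congr rfl fun i hi => (hf i (hS i hi) (hJ (hSJ hi) (hS i hi))).2.1
    · rw [hy]
      refine le_antisymm ?_ (Finset.le_inf fun i hi => hfs j (hSJ hj) i (hSJ hi) (hS j hj) (hS i hi))
      exact (Finset.inf_le hj).trans (hf j (hS j hj) (hJ (hSJ hj) (hS j hj))).2.2.1.le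
    · rw [hy, Finset.lt_inf_iff (WithTop.coe_lt_top _)]
      exact fun i hi => (hf i (hS i hi) (hJ (hSJ hi) (hS i hi))).2.2.2 j hjs
        fun h => hjS (h ▸ hi)
  have hcontains : ∀ A : Set J, (⟨s, hsJ⟩ : J) ∈ A → (∃ i ∈ A, (i : ι) ≠ s) →
      ∃ y ∈ N, ∀ j : J, (j ∈ A → w j y = β j) ∧ (j ∉ A → (β j : WithTop ℤ) < w j y) := by
    rintro A hsA ⟨i, hiA, his⟩
    let S : Finset ι := J.filter fun j => j ≠ s ∧ ∃ hj : j ∈ J, (⟨j, hj⟩ : J) ∈ A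
    obtain ⟨y, hyN, hys, hy1, hy2⟩ := hinf S (Finset.filter_subset _ _) (by simp [S])
      ⟨i, by simpa [S] using ⟨his, hiA⟩⟩
    refine ⟨y, hyN, fun j => ⟨fun hj => ?_, fun hj => ?_⟩⟩
    · by_cases hjs : (j : ι) = s
      · rw [hβs j hjs, hjs, hys]
      · rw [hβ j hjs]
        exact hy1 j (by simpa [S] using ⟨hjs, hj⟩)
    · have hjs : (j : ι) ≠ s := fun h => hj (by rwa [show j = ⟨s, hsJ⟩ from Subtype.ext h])
      rw [hβ j hjs]
      exact hy2 j j.2 hjs (by simpa [S] using fun _ => hj)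
  refine ⟨J, hsJ, hJs, β, ⟨Or.inr ⟨natCard_ne_one hsJ hJs, ?_, ?_⟩, ?_⟩, hβs _ rfl⟩
  · obtain ⟨y, hyN, hy⟩ := hcontains Set.univ trivial ⟨⟨i₀, hi₀J⟩, trivial, hi₀⟩
    exact ⟨y, hyN, fun j => (hy j).1 trivial⟩
  · rw [fiber, Set.iUnion_eq_empty]
    intro i
    rw [← Set.not_nonempty_iff_eq_empty, fiberOver_valuesOn_nonempty_iff hw hγ]
    rintro ⟨x, hxN, hx⟩
    have hxi := (hx i).1 rfl
    have hxj := fun j (hj : j ≠ i) => (hx j).2 hj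
    by_cases his : (i : ι) = s
    · rw [hβs i his, his] at hxi
      obtain ⟨j, hjs, hj⟩ := hno x hxN hxi
      have := hxj j fun h => hjs (h ▸ his)
      rw [hβ j hjs] at this
      exact this.not_ge hj
    · obtain ⟨hfN, hfsi, hfi, hfj⟩ := hf i his (hJ i.2 his)
      rw [hβ i his] at hxi
      -- Cancelling `x` against `f i` at `i` would reach `t`: the order at `i` rises above `t i`,
      -- while at `s` it stays `a`, because `x` is larger there.
      obtain ⟨z, hzN, hz1, hz2, hz3⟩ := exists_exchange hw hxN hfN (hxi.trans hfi.symm)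
        (hfi ▸ WithTop.coe_ne_top)
      have hlt : w s (f i) < w s x := by
        have := hxj ⟨s, hsJ⟩ fun h => his (congrArg Subtype.val h).symm
        rwa [hβs _ rfl, ← hfsi] at this
      obtain ⟨j, hjs, hj⟩ := hno z hzN (by rw [hz3 s hlt.ne', min_eq_right hlt.le, hfsi])
      refine hj.not_gt ?_
      by_cases hji : j = i
      · rwa [hji, ← hfi]
      · have h1 := hxj j hji
        rw [hβ j hjs] at h1
        exact (lt_min h1 (hfj j hjs fun h => hji (Subtype.ext h))).trans_le (hz2 j)
  · intro A hA
    rw [fiberOver_valuesOn_nonempty_iff hw hγ]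
    obtain ⟨i, hi, j, hj, hij⟩ := (Set.one_lt_ncard (Set.toFinite A)).mp hA
    by_cases hsA : (⟨s, hsJ⟩ : J) ∈ A
    · apply hcontains A hsA
      by_cases his : (i : ι) = s
      · exact ⟨j, hj, fun h => hij (Subtype.ext (his.trans h.symm))⟩
      · exact ⟨i, hi, his⟩
    -- Split `A` into `i` and the rest `S`, and exchange at `s` the element `f i` with a minimum
    -- over `S`. The order at `s` rises above `a`, and at each place of `A` exactly one of the two
    -- attains `t`, so nothing cancels there.
    · have hAs : ∀ j ∈ A, (j : ι) ≠ s := fun j hj h =>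
        hsA (by rwa [show j = ⟨s, hsJ⟩ from Subtype.ext h] at hj)
      obtain ⟨hfN, hfsi, hfi, hfj⟩ := hf i (hAs i hi) (hJ i.2 (hAs i hi))
      let S : Finset ι := J.filter fun j => j ≠ i ∧ ∃ hj : j ∈ J, (⟨j, hj⟩ : J) ∈ A
      have hmemS : ∀ l : J, (l : ι) ∈ S ↔ l ≠ i ∧ l ∈ A := fun l =>
        ⟨fun h => have ⟨_, h1, _, h2⟩ := Finset.mem_filter.mp h
          ⟨fun e => h1 (congrArg Subtype.val e), h2⟩,
          fun h => Finset.mem_filter.mpr ⟨l.2, fun e => h.1 (Subtype.ext e), l.2, h.2⟩⟩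
      obtain ⟨y, hyN, hys, hy1, hy2⟩ := hinf S (Finset.filter_subset _ _)
        (fun h => hsA ((hmemS ⟨s, hsJ⟩).mp h).2) ⟨j, (hmemS j).mpr ⟨hij.symm, hj⟩⟩
      obtain ⟨z, hzN, hz1, hz2, hz3⟩ := exists_exchange hw hfN hyN (hfsi.trans hys.symm)
        (hys ▸ WithTop.coe_ne_top)
      refine ⟨z, hzN, fun l => ⟨fun hl => ?_, fun hl => ?_⟩⟩
      · rw [hβ l (hAs l hl)]
        by_cases hli : l = i
        · subst hli
          have := hy2 l l.2 (hAs l hl) fun h => ((hmemS l).mp h).1 rfl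
          rw [hz3 l (by rw [hfi]; exact this.ne), hfi, min_eq_left this.le]
        · have h1 := hfj l (hAs l hl) fun h => hli (Subtype.ext h)
          have h2 := hy1 l ((hmemS l).mpr ⟨hli, hl⟩)
          rw [hz3 l (by rw [h2]; exact h1.ne'), h2, min_eq_right h1.le]
      · by_cases hls : (l : ι) = s
        · rw [hβs l hls, hls, ← hys]
          exact hz1
        · rw [hβ l hls]
          exact (lt_min (hfj l hls fun h => hl (by rwa [Subtype.ext h]))
            (hy2 l l.2 hls fun h => hl ((hmemS l).mp h).2)).trans_le (hz2 l)

/-- The interval `[m s, γ s)` is made up of the values at `s` of the elements of `N` that reach the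
conductor at the other places, the gaps at `s`, and the coordinates of relative maximals. -/
theorem card_filter_reaches [Finite ι] [Infinite k]
    (hw : ∀ i, IsOrderFunction k (R := R) (w i))
    (hγ : ∀ β, γ ≤ β → ∃ g ∈ N, ∀ i, w i g = β i) (hm : ∀ x ∈ N, ∀ i, (m i : WithTop ℤ) ≤ w i x)
    (s : ι) (hms : ∃ x ∈ N, w s x = m s) [DecidablePred fun a => Reaches w N s a fun i => γ i - 1] :
    (maximalPoints (valuesOn w N {s})).Finite ∧ (relMaxCoords w N s).Finite ∧
      (((Finset.Ico (m s) (γ s)).filter fun a => Reaches w N s a fun i => γ i - 1).card : ℤ) +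
        (maximalPoints (valuesOn w N {s})).ncard + (relMaxCoords w N s).ncard = γ s - m s := by
  classical
  let gaps : Finset ℤ := (Finset.Ico (m s) (γ s)).filter fun a => ¬ ∃ x ∈ N, w s x = a
  let rel : Finset ℤ := (Finset.Ico (m s) (γ s)).filter fun a =>
    (∃ x ∈ N, w s x = a) ∧ ¬ Reaches w N s a fun i => γ i - 1
  -- This confines gaps and relative maximal coordinates to the interval below `γ s`.
  have hlarge : ∀ a, γ s ≤ a → Reaches w N s a fun i => γ i - 1 := fun a ha => by
    obtain ⟨g, hg, h⟩ := hγ (Function.update γ s a)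
      (le_update_iff.mpr ⟨ha, fun _ _ => le_rfl⟩)
    refine ⟨g, hg, by rw [h, Function.update_self], fun i hi => ?_⟩
    rw [h, Function.update_of_ne hi, WithTop.coe_lt_coe]
    exact sub_one_lt _
  have hrel : relMaxCoords w N s = rel := by
    ext a
    simp only [rel, Finset.coe_filter, Finset.mem_Ico, Set.mem_ofPred_eq]
    constructor
    · intro ha
      obtain ⟨x, hx, hxa⟩ := exists_of_mem_relMaxCoords ha
      have hr := not_reaches_of_mem_relMaxCoords hw hγ ha
      refine ⟨⟨WithTop.coe_le_coe.mp ((hm x hx s).trans_eq hxa), ?_⟩, ⟨x, hx, hxa⟩, hr⟩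
      by_contra! h
      exact hr (hlarge a h)
    · rintro ⟨-, h1, h2⟩
      exact mem_relMaxCoords_of_not_reaches hw hγ hm h1 h2
  let ev : (({s} : Finset ι) → ℤ) → ℤ := fun α => α ⟨s, Finset.mem_singleton_self s⟩
  have hsub : ∀ j : ({s} : Finset ι), j = ⟨s, Finset.mem_singleton_self s⟩ := fun j =>
    Subtype.ext (Finset.mem_singleton.mp j.2)
  have hev : Function.Injective ev := fun α β h => funext fun j => by rw [hsub j]; exact h
  have hmem : ∀ α, α ∈ valuesOn w N {s} ↔ ∃ x ∈ N, w s x = ev α := fun α => by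
    constructor
    · rintro ⟨x, hx, h⟩
      exact ⟨x, hx, h ⟨s, Finset.mem_singleton_self s⟩⟩
    · rintro ⟨x, hx, h⟩
      exact ⟨x, hx, fun j => by rw [hsub j]; exact h⟩
  have hgaps : ev '' maximalPoints (valuesOn w N {s}) = gaps := by
    ext a
    simp only [gaps, Finset.coe_filter, Finset.mem_Ico, Set.mem_ofPred_eq]
    constructor
    · rintro ⟨α, ⟨-, h1, μ, h2, h3⟩ | ⟨h, -⟩, rfl⟩
      · rw [hmem] at h1 h2
        refine ⟨⟨?_, ?_⟩, h1⟩
        · obtain ⟨x, hx, hxμ⟩ := h2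
          exact (WithTop.coe_le_coe.mp ((hm x hx s).trans_eq hxμ)).trans (h3 _)
        · by_contra! h
          obtain ⟨x, hx, hxs, -⟩ := hlarge _ h
          exact h1 ⟨x, hx, hxs⟩
      · exact absurd (by simp) h
    · rintro ⟨⟨h1, h2⟩, h3⟩
      exact ⟨fun _ => a, Or.inl ⟨by simp, fun h => h3 ((hmem _).mp h), fun _ => m s,
        (hmem _).mpr hms, fun _ => h1⟩, rfl⟩
  have hgapsfin : (maximalPoints (valuesOn w N {s})).Finite :=
    Set.Finite.of_finite_image (hgaps ▸ gaps.finite_toSet) hev.injOn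
  refine ⟨hgapsfin, hrel ▸ rel.finite_toSet, ?_⟩
  rw [← Set.ncard_image_of_injective _ hev, hgaps, hrel, Set.ncard_coe_finset,
    Set.ncard_coe_finset]
  have hmγ : m s ≤ γ s := by
    obtain ⟨g, hg, h⟩ := hγ γ le_rfl
    exact WithTop.coe_le_coe.mp ((hm g hg s).trans_eq (h s))
  have h1 : ((Finset.Ico (m s) (γ s)).card : ℤ) = γ s - m s := by
    rw [Int.card_Ico, Int.toNat_of_nonneg (by omega)]
  rw [← h1, ← Finset.card_filter_add_card_filter_not (s := Finset.Ico (m s) (γ s)) fun a : ℤ =>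
    ∃ x ∈ N, w s x = a, ← Finset.card_filter_add_card_filter_not
    (s := (Finset.Ico (m s) (γ s)).filter fun a : ℤ => ∃ x ∈ N, w s x = a)
    fun a => Reaches w N s a fun i => γ i - 1, Finset.filter_filter, Finset.filter_filter]
  have h2 : (Finset.Ico (m s) (γ s)).filter (fun a : ℤ => (∃ x ∈ N, w s x = a) ∧
      Reaches w N s a fun i => γ i - 1) =
      (Finset.Ico (m s) (γ s)).filter fun a => Reaches w N s a fun i => γ i - 1 :=
    Finset.filter_congr fun a _ => and_iff_right_of_imp fun ⟨x, hx, hxs, _⟩ => ⟨x, hx, hxs⟩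
  rw [h2]
  push_cast
  simp only [gaps, rel]
  ring

end RelativeMaximals

end AlgebroidCurve

namespace AlgebroidCurve

/-! ### Finiteness of the lengths -/

section Finiteness

variable {k R M : Type*} [Field k] [CommRing R] [Algebra k R] [AddCommGroup M] [Module R M]
  {ι : Type*} {w : ι → M → WithTop ℤ} {N : Submodule R M} {γ m : ι → ℤ}

theorem colength_inf (N N' : Submodule R M) : colength N (N ⊓ N') = colength N N' := by
  have : (N ⊓ N').submoduleOf N = N'.submoduleOf N := by
    ext x
    rw [mem_submoduleOf, mem_submoduleOf]
    exact and_iff_right x.2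
  rw [colength, this, colength]

/-- The conditions are imposed one place at a time; each costs at most the number of integers
between the lower bound `m i` and `γ i`. -/
theorem colength_inf_iInf_ne_top [Finite ι] (hw : ∀ i, IsOrderFunction k (R := R) (w i))
    (hm : ∀ x ∈ N, ∀ i, (m i : WithTop ℤ) ≤ w i x) (γ : ι → ℤ) :
    colength N (N ⊓ ⨅ i, (hw i).submodule (γ i)) ≠ ⊤ := by
  classical
  have key : ∀ F : Finset ι, colength N (N ⊓ ⨅ i ∈ F, (hw i).submodule (γ i)) ≠ ⊤ := by
    intro F
    induction F using Finset.induction_on with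
    | empty => simp [colength_eq_zero_iff.mpr (le_refl N)]
    | insert i F _ ih =>
      have h1 : N ⊓ ⨅ j ∈ insert i F, (hw j).submodule (γ j) =
          (N ⊓ ⨅ j ∈ F, (hw j).submodule (γ j)) ⊓ (hw i).submodule (γ i) := by
        rw [Finset.iInf_insert, inf_assoc, inf_comm ((hw i).submodule _)]
      rw [h1, colength_eq_add inf_le_left inf_le_left]
      refine WithTop.add_ne_top.mpr ⟨ih, ?_⟩
      generalize hP : N ⊓ ⨅ j ∈ F, (hw j).submodule (γ j) = P
      have hPm : P ⊓ (hw i).submodule (min (m i) (γ i)) = P := by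
        rw [inf_eq_left, ← hP]
        exact fun x hx => (WithTop.coe_le_coe.mpr (min_le_left _ _)).trans (hm x hx.1 i)
      have := (hw i).colength_submodule P (min_le_right (m i) (γ i))
      rw [hPm] at this
      rw [this]
      exact WithTop.coe_ne_top
  cases nonempty_fintype ι
  simpa using key Finset.univ

end Finiteness

/-! ### Value sets of fractional ideals -/

section Curve

variable {k O : Type*} [Field k] [CommRing O] [Algebra k O] {κ : Type*}

theorem isOrderFunction_coord (hO : IsCurveRing k O) (q : κ → minimalPrimes O) {M : Type*}
    [AddCommGroup M] [Module O M] (π : M →ₗ[O] (∀ j, BranchField (q j))) (j : κ) :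
    IsOrderFunction k (R := O) fun x => branchVal (q j) (π x j) :=
  (isOrderFunction_branchVal hO (q j)).comp (LinearMap.proj j ∘ₗ π)

theorem truncation_eq (hO : IsCurveRing k O) (q : κ → minimalPrimes O) {M : Type*}
    [AddCommGroup M] [Module O M] (π : M →ₗ[O] (∀ j, BranchField (q j))) (N : Submodule O M)
    (α : κ → ℤ) :
    truncation q π N α = N ⊓ ⨅ j, (isOrderFunction_coord hO q π j).submodule (α j) := by
  rw [truncation, ← Submodule.span_eq (N ⊓ ⨅ j, (isOrderFunction_coord hO q π j).submodule (α j))]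
  congr 1
  ext x
  rw [SetLike.mem_coe, Submodule.mem_inf, Submodule.mem_iInf]
  rfl

/-- A finite value already forces a nonzero component, so value sets can be read off from elements
of the total ring of fractions. -/
theorem mem_valueSet_iff (hO : IsCurveRing k O) (q : κ → minimalPrimes O)
    (N : Submodule O (FractionRing O)) (α : κ → ℤ) :
    α ∈ valueSet q N ↔ ∃ x ∈ N, ∀ j, branchVal (q j) (projPi q x j) = α j := by
  constructor
  · rintro ⟨_, ⟨x, hx, rfl⟩, h⟩
    exact ⟨x, hx, fun j => (h j).2⟩
  · rintro ⟨x, hx, h⟩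
    refine ⟨_, ⟨x, hx, rfl⟩, fun j => ⟨fun h0 => ?_, h j⟩⟩
    have := h j
    rw [h0, (branchVal_eq_top_iff hO _).mpr rfl] at this
    exact WithTop.top_ne_coe this

theorem valueSetOn_eq (hO : IsCurveRing k O) {r : ℕ} (p : Fin r → minimalPrimes O)
    (N : Submodule O (FractionRing O)) (J : Finset (Fin r)) :
    valueSetOn p N J = valuesOn (fun i x => branchVal (p i) (projPi p x i)) N J :=
  Set.ext fun _ => mem_valueSet_iff hO _ N _

theorem branchVal_algebraMap_ne_top (hO : IsCurveRing k O) (q : minimalPrimes O) {a : O}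
    (ha : a ∈ O⁰) : branchVal q (algebraMap O (BranchField q) a) ≠ ⊤ := by
  rw [Ne, branchVal_eq_top_iff hO]
  exact (isUnit_algebraMap_branchField q ⟨a, ha⟩).ne_zero

/-- With `d` a common denominator, orders on `I` are at least minus the order of `d`. -/
theorem exists_le_branchVal (hO : IsCurveRing k O) (q : κ → minimalPrimes O)
    (I : FractionalIdeal O⁰ (FractionRing O)) (j : κ) :
    ∃ b : ℤ, ∀ x ∈ (I : Submodule O (FractionRing O)),
      (b : WithTop ℤ) ≤ branchVal (q j) (projPi q x j) := by
  obtain ⟨d, hd, h⟩ := I.isFractional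
  obtain ⟨n, hn⟩ := WithTop.ne_top_iff_exists.mp (branchVal_algebraMap_ne_top hO (q j) hd)
  refine ⟨-n, fun x hx => ?_⟩
  obtain ⟨c, hc⟩ := h x hx
  have h1 : projPi q (d • x) j = algebraMap O (BranchField (q j)) c := by
    rw [← hc]
    exact (proj (q j)).commutes c
  rw [map_smul, Pi.smul_apply, Algebra.smul_def] at h1
  have h2 := branchVal_algebraMap_nonneg hO (q j) c
  rw [← h1, branchVal_mul hO, ← hn] at h2
  generalize branchVal (q j) (projPi q x j) = v at h2
  induction v with
  | top => exact le_top
  | coe v =>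
    rw [← WithTop.coe_add, ← WithTop.coe_zero, WithTop.coe_le_coe] at h2
    rw [WithTop.coe_le_coe]
    omega

/-- Each coordinate is bounded below and attains its minimum at some element; one general
combination of these elements attains all the minima at once. -/
theorem exists_isLeast_valueSet (hO : IsCurveRing k O) [Finite κ] (q : κ → minimalPrimes O)
    (I : FractionalIdeal O⁰ (FractionRing O))
    (hI : ∃ a ∈ O⁰, algebraMap O (FractionRing O) a ∈ I) :
    ∃ m, IsLeast (valueSet q (I : Submodule O (FractionRing O))) m := by
  have := hO.isAlgClosed
  have : Infinite k := inferInstance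
  cases nonempty_fintype κ
  obtain ⟨a, ha, haI⟩ := hI
  have hne : ∀ j, ∃ n : ℤ, branchVal (q j) (projPi q (algebraMap O (FractionRing O) a) j) = n :=
    fun j => by
      obtain ⟨n, hn⟩ := WithTop.ne_top_iff_exists.mp (branchVal_algebraMap_ne_top hO (q j) ha)
      refine ⟨n, ?_⟩
      rw [hn]
      exact congrArg _ ((proj (q j)).commutes a)
  choose α hα using hne
  have hαE : α ∈ valueSet q (I : Submodule O (FractionRing O)) :=
    (mem_valueSet_iff hO q _ α).mpr ⟨_, haI, hα⟩
  have hleast : ∀ j, ∃ m : ℤ, (∃ β ∈ valueSet q (I : Submodule O (FractionRing O)), β j = m) ∧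
      ∀ z, (∃ β ∈ valueSet q (I : Submodule O (FractionRing O)), β j = z) → m ≤ z := fun j => by
    obtain ⟨b, hb⟩ := exists_le_branchVal hO q I j
    refine Int.exists_least_of_bdd ⟨b, ?_⟩ ⟨_, α, hαE, rfl⟩
    rintro _ ⟨β, hβ, rfl⟩
    obtain ⟨x, hx, h⟩ := (mem_valueSet_iff hO q _ β).mp hβ
    exact WithTop.coe_le_coe.mp ((hb x hx).trans_eq (h j))
  choose m hm hmin using hleast
  choose β hβ hβm using hm
  choose x hx hxβ using fun j => (mem_valueSet_iff hO q _ (β j)).mp (hβ j)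
  obtain ⟨y, hy, hyv⟩ := exists_eq_finset_inf (isOrderFunction_coord hO q (projPi q))
    Finset.univ x fun j _ => hx j
  refine ⟨m, (mem_valueSet_iff hO q _ m).mpr ⟨y, hy, fun j => ?_⟩, fun δ hδ j => hmin j _ ⟨δ, hδ, rfl⟩⟩
  rw [hyv]
  refine le_antisymm ((Finset.inf_le (Finset.mem_univ j)).trans_eq ?_)
    (Finset.le_inf fun i _ => ?_)
  · rw [hxβ, hβm]
  · rw [hxβ, WithTop.coe_le_coe]
    exact hmin j _ ⟨β i, hβ i, rfl⟩

end Curve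

end AlgebroidCurve

/-! ### The length formula -/

open AlgebroidCurve in
theorem mainTheorem4 {k O : Type*} [Field k] [CommRing O] [Algebra k O]
    (hO : IsCurveRing k O) {n : ℕ} (p : Fin (n + 1) ≃ minimalPrimes O)
    (I : FractionalIdeal (nonZeroDivisors O) (FractionRing O))
    (hI : ∃ a ∈ nonZeroDivisors O, algebraMap O (FractionRing O) a ∈ I) :
    ∃ m : Fin (n + 1) → ℤ, IsLeast (valueSet p (I : Submodule O (FractionRing O))) m ∧
      ∀ γ : Fin (n + 1) → ℤ, Set.Ici γ ⊆ valueSet p (I : Submodule O (FractionRing O)) →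
        let N : Submodule O (FractionRing O) := I
        let p' : Fin n → minimalPrimes O := fun i => p i.castSucc
        let N' : Submodule O (∀ i, BranchField (p' i)) := Submodule.map (projPi p') N
        let ℓ : ℕ∞ := colength N (truncation p (projPi p) N γ)
        let ℓ' : ℕ∞ := colength N' (truncation p' LinearMap.id N' fun i => γ i.castSucc)
        let M := maximalPoints (valueSetOn p N {Fin.last n})
        let R := relativeMaximalCoords p N (Fin.last n)
        ℓ ≠ ⊤ ∧ ℓ' ≠ ⊤ ∧ M.Finite ∧ R.Finite ∧
          (ℓ.toNat : ℤ) =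
            ℓ'.toNat + (γ (Fin.last n) - m (Fin.last n)) - M.ncard - R.ncard := by
  classical
  have := hO.isAlgClosed
  have : Infinite k := inferInstance
  obtain ⟨m, hmE, hmin⟩ := exists_isLeast_valueSet hO p I hI
  refine ⟨m, ⟨hmE, hmin⟩, fun γ hγE => ?_⟩
  intro N p' N' ℓ ℓ' M R
  let w : Fin (n + 1) → FractionRing O → WithTop ℤ := fun i x => branchVal (p i) (projPi p x i)
  have hw : ∀ i, IsOrderFunction k (R := O) (w i) := isOrderFunction_coord hO p (projPi p)
  have hγ : ∀ β, γ ≤ β → ∃ g ∈ N, ∀ i, w i g = β i := fun β hβ =>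
    (mem_valueSet_iff hO p N β).mp (hγE hβ)
  -- An element with zero components gives no point of the value set; it is perturbed first, keeping
  -- its finite orders.
  have hm : ∀ x ∈ N, ∀ i, (m i : WithTop ℤ) ≤ w i x := by
    intro x hx i
    obtain ⟨y, hy, h⟩ := exists_add_of_conductor hw hγ hx 0
    choose β hβ hβ' using h
    rcases hβ' i with h | ⟨h, -⟩
    · rw [h, WithTop.coe_le_coe]
      exact hmin ((mem_valueSet_iff hO p N β).mpr ⟨y, hy, hβ⟩) i
    · rw [h]
      exact le_top
  have hM : M = maximalPoints (valuesOn w N {Fin.last n}) := by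
    simp only [M, valueSetOn_eq hO]
    rfl
  have hR : R = relMaxCoords w N (Fin.last n) := by
    simp only [R, relativeMaximalCoords, valueSetOn_eq hO]
    rfl
  obtain ⟨x₀, hx₀, hx₀m⟩ := (mem_valueSet_iff hO p N m).mp hmE
  obtain ⟨h1, h2, hcard⟩ := card_filter_reaches hw hγ hm (Fin.last n) ⟨x₀, hx₀, hx₀m _⟩
  let P : Submodule O (FractionRing O) := N ⊓ ⨅ i : Fin n, (hw i.castSucc).submodule (γ i.castSucc)
  have hP : ∀ x, x ∈ P ↔ x ∈ N ∧ ∀ i : Fin n, (γ i.castSucc : WithTop ℤ) ≤ w i.castSucc x :=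
    fun x => by
      rw [Submodule.mem_inf, Submodule.mem_iInf]
      rfl
  have hT : truncation p (projPi p) N γ = P ⊓ (hw (Fin.last n)).submodule (γ (Fin.last n)) := by
    rw [truncation_eq hO]
    ext x
    rw [Submodule.mem_inf, Submodule.mem_iInf, Submodule.mem_inf, hP, Fin.forall_fin_succ',
      and_assoc]
    rfl
  have hPm : P ⊓ (hw (Fin.last n)).submodule (m (Fin.last n)) = P :=
    inf_eq_left.mpr fun x hx => hm x ((hP x).mp hx).1 _
  have hℓ' : ℓ' = colength N P := by
    simp only [ℓ', N']
    rw [colength_map, ← colength_inf, truncation_eq hO]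
    congr 1
    ext x
    rw [Submodule.mem_inf, Submodule.mem_comap, Submodule.mem_inf, Submodule.mem_iInf, hP]
    refine and_congr_right fun hx => ?_
    rw [and_iff_right (Submodule.mem_map_of_mem hx)]
    rfl
  have hℓ'fin : ℓ' ≠ ⊤ := by
    rw [hℓ']
    exact colength_inf_iInf_ne_top (fun i : Fin n => hw i.castSucc)
      (fun x hx i => hm x hx i.castSucc) _
  have hmγ : m (Fin.last n) ≤ γ (Fin.last n) := hmin (hγE Set.self_mem_Ici) _
  have hℓ : ℓ = ℓ' + (((Finset.Ico (m (Fin.last n)) (γ (Fin.last n))).filter fun a =>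
      Reaches w N (Fin.last n) a fun i => γ i - 1).card : ℕ) := by
    have h3 := (hw (Fin.last n)).colength_submodule P hmγ
    rw [hPm] at h3
    simp only [ℓ]
    rw [hT, colength_eq_add inf_le_left (inf_le_left : P ≤ N), ← hℓ', h3]
    congr 3
    -- An order `a` occurs in `P` exactly when `a` is reached with strict thresholds `γ - 1`.
    refine Finset.filter_congr fun a _ => ⟨?_, ?_⟩
    · rintro ⟨x, hx, hxa⟩
      refine ⟨x, ((hP x).mp hx).1, hxa, fun i hi => ?_⟩
      obtain ⟨j, rfl⟩ := Fin.exists_castSucc_eq.mpr hi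
      exact coe_sub_one_lt_iff.mpr (((hP x).mp hx).2 j)
    · rintro ⟨x, hx, hxa, hxi⟩
      exact ⟨x, (hP x).mpr ⟨hx, fun i => coe_sub_one_lt_iff.mp (hxi _ (Fin.castSucc_ne_last i))⟩, hxa⟩
  refine ⟨?_, hℓ'fin, hM ▸ h1, hR ▸ h2, ?_⟩
  · rw [hℓ]
    exact WithTop.add_ne_top.mpr ⟨hℓ'fin, WithTop.coe_ne_top⟩
  · rw [hM, hR, hℓ, ENat.toNat_add hℓ'fin (ENat.natCast_ne_top _), ENat.toNat_natCast]
    push_cast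
    linarith
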